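/- **Theorem (Soundness of the probabilistic IFF proof procedure).** *Programs.* A program consists of a set $\mathcal A$ of abducible predicates; a finite list $KB$ of clauses $h\leftarrow b_1,\dots,b_m$ ($h$ an atom whose predicate is not in $\mathcal A$, the $b_i$ literals); a finite list $IC_{np}$ of integrity constraints (ICs) $b_1,\dots,b_n\to H_1\vee\dots\vee H_k$ (the $b_i$ atoms, each $H_i$ a conjunction of literals; $k=0$ means *false*); and finitely many probabilistic ICs (PICs) $p_i::ic_i$ with $p_i\in[0,1]$ and $ic_i$ an IC. A goal $G$ is a conjunction of literals. Variables of clauses and ICs are universally quantified. An atomic choice is a triple $(ic_i,\tau,k)$ with $\tau$ a substitution for the variables of $ic_i$ and $k\in\{0,1\}$; a set $E$ of atomic choices is consistent (a composite choice) if it never contains both $(ic_i,\tau,0)$ and $(ic_i,\tau,1)$. *Semantics.* A three-valued structure has a domain, two-valued functions and equality (which is identity), and three-valued predicates; connectives and quantifiers are strong Kleene, and $B\to H$ means $\neg B\vee H$. Let $\Delta$ be a set of abducible atoms, possibly with variables. A structure $M$ with an assignment $v$ of the variables of $\Delta$ is a model of the completion of $KB\cup\Delta$ if $M$ satisfies Clark's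 equality theory and every ground atom has the same truth value as the disjunction of the right-hand sides of its completed definition, the definition of an abducible predicate being given by the atoms of $\Delta$. For $\Phi$ that may share variables with $\Delta$, $KB\cup\Delta\models\Phi$ means that $\Phi$ is true in every $M$ under every $v$ such that $(M,v)$ is a model of the completion of $KB\cup\Delta$. (So the variables of $\Delta$ are existential in the premise.) The pair $(\Delta,\theta)$ is a *probabilistic abductive answer* for $G$ in $E$ if $\Delta$ consists of abducible atoms, $E$ is consistent, $KB\cup\Delta\models G\theta$, $KB\cup\Delta\models ic$ for every $ic\in IC_{np}$, and $KB\cup\Delta\models ic_i\tau$ for every $(ic_i,\tau,1)\in E$. *Procedure.* A node is $\langle R,\Delta,PSIC,E,\theta\rangle$: a resolvent $R$ (literals, equations, disequalities, disjunctions), abduced atoms $\Delta$, a multiset $PSIC$ of implications, atomic choices $E$, and a substitution $\theta$ for the variables of $G$. Variables of an implication are either local and universal, or existential and shared with the node. The initial node is $\langle G,\emptyset,IC_{np}\cup PIC,\emptyset,\emptyset\rangle$; each PIC is decorated with itself and a substitution, initially empty, and every substitution applied to an implication or to a node is applied to the decorations, to $E$ and to $\theta$ as well. Each transition replaces a node by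 one child, as follows (a disjunction stands for alternative children; new variables are fresh). 1. *Abduction and negation.* An abducible atom of $R$ moves to $\Delta$; $\neg a$ in $R$ becomes the implication $a\to false$ in $PSIC$. 2. *Unfolding.* A non-abducible atom $p(N)$ of $R$ is replaced by $N=N',B$ for some clause $p(N')\leftarrow B$. An implication $p(N),B\to H$ with $p$ non-abducible is replaced by the implications $N=N',B',B\to H$, one for each clause $p(N')\leftarrow B'$, the clause variables being universal. 3. *Propagation.* If $a(N)\in\Delta$ and $a(N'),B\to H$ is in $PSIC$, add $N=N',B\to H$, once for each pair of an abduced atom and a body atom of the implication. 4. *Equality rewriting*, in $R$ and in the bodies of implications: $f(\bar s)=f(\bar t)$ becomes $s_1=t_1,\dots,s_n=t_n$; $f(\bar s)=g(\bar t)$ with $f\ne g$ is false; $x=x$ is true; $x=t$ is false if $x$ occurs in $t\neq x$. In $R$, $x=t$ with $x$ not in $t$ applies $\{x/t\}$ to the node, provided $E$ stays consistent. In a body, $y=t$ with $y$ universal and not in $t$ applies $\{y/t\}$ to the implication. An implication with false body is deleted. In $R$: $f(\bar s)\ne f(\bar t)$ becomes $s_1\ne t_1\vee\dots\vee s_n\ne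 t_n$; $f(\bar s)\neq g(\bar t)$ with $f\ne g$ is true; $x\ne x$ is false; $x\ne t$ is true if $x$ occurs in $t\ne x$; $\forall y\,(y\ne t)$ is false if $y$ is not in $t$. 5. *Case analysis.* For an implication $x=t,B\to H$ with $x$ existential, not in $t$, and $t$ not a universal variable: replace it by $x=t$ in $R$ together with $B\to H$, the universal variables of $t$ becoming existential; or by $x\ne t$ in $R$, closed universally over the universal variables of $t$. 6. *Factoring*, once for each pair of distinct atoms $a(N),a(N')\in\Delta$: add $N=N'$ to $R$, or add $N\ne N'$ (as a disjunction) to $R$. 7. *Splitting.* A disjunction in $R$ is replaced by one of its disjuncts; the empty disjunction is $false$, and no transition applies to it. 8. *Negation in bodies.* If only negative literals are left in the body $\neg a,B$ of an implication with head $H$, replace it by the atom $a$ in $R$ (if $a$ has no universal variable), or by $B\to H$. 9. *Logical equivalence*, for $true\to A$ where $A$ has no universal variable: a non-probabilistic implication is replaced by $A$ in $R$. A probabilistic one, decorated with $ic_i\tau$, is either deleted with $A$ added to $R$ and $(ic_i,\tau,1)$ added to $E$, provided $(ic_i,\tau,0)\notin E$; or deleted with $(ic_i,\tau,0)$ added to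 $E$, provided $(ic_i,\tau,1)\notin E$ (for this last alternative $A$ may have universal variables). 10. *Floundering.* If $A$ in $true\to A$ contains a universal variable, the branch may fail: $false$ is added to $R$. A derivation for $G$ is *successful*, with abduced set $\Delta$, explanation $E$ and substitution $\theta$, if it leads from the initial node to a node $\langle\emptyset,\Delta,PSIC,E,\theta\rangle$ to which no transition is applicable. *Claim.* If there is a successful derivation for $G$ with abduced set $\Delta$, explanation $E$ and substitution $\theta$, then $(\Delta,\theta)$ is a probabilistic abductive answer for $G$ in the explanation $E$: $E$ is consistent, and $KB\cup\Delta$ entails, in the three-valued completion semantics, $G\theta$, every non-probabilistic IC, and $ic_i\tau$ for every $(ic_i,\tau,1)\in E$. -/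

import Mathlib

universe u v w

namespace ProbIFF

/-! ### Syntax

The language `L` supplies the function symbols (`L.Functions n`, used in terms) and the
predicate symbols (`L.Relations n`). -/

/-- A predicate symbol together with its arity. -/
abbrev Pred (L : FirstOrder.Language.{u, v}) : Type v := Σ n, L.Relations n

/-- Atoms `p(t₁, …, tₙ)` with variables in `α`. -/
structure Atom (L : FirstOrder.Language.{u, v}) (α : Type) where
  pred : Pred L
  args : Fin pred.1 → L.Term α

/-- Literals: atoms and negated atoms. -/
inductive Literal (L : FirstOrder.Language.{u, v}) (α : Type) where
  | pos (a : Atom L α)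
  | neg (a : Atom L α)

/-- A disjunction of conjunctions of literals. The empty disjunction is `false`, the empty
conjunction is `true`. -/
abbrev Head (L : FirstOrder.Language.{u, v}) (α : Type) := List (List (Literal L α))

/-- A clause `head ← body`; its variables are indexed by `Fin nvars`. -/
structure Clause (L : FirstOrder.Language.{u, v}) where
  nvars : ℕ
  head : Atom L (Fin nvars)
  body : List (Literal L (Fin nvars))

/-- An integrity constraint `b₁, …, bₙ → H₁ ∨ … ∨ Hₖ`. -/
structure IC (L : FirstOrder.Language.{u, v}) where
  nvars : ℕ
  body : List (Atom L (Fin nvars))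
  head : Head L (Fin nvars)

/-- A probabilistic integrity constraint `p :: Body → Head`. -/
structure PIC (L : FirstOrder.Language.{u, v}) where
  prob : Set.Icc (0 : ℝ) 1
  ic : IC L

/-- A goal: a conjunction of literals; its variables are indexed by `Fin nvars`. -/
structure Goal (L : FirstOrder.Language.{u, v}) where
  nvars : ℕ
  lits : List (Literal L (Fin nvars))

/-- A probabilistic abductive logic program. -/
structure Program (L : FirstOrder.Language.{u, v}) where
  /-- the abducible predicates -/
  abd : Set (Pred L)
  kb : List (Clause L)
  /-- clauses do not define abducible predicates -/
  kb_head : ∀ c ∈ kb, c.head.pred ∉ abd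
  /-- the non-probabilistic integrity constraints -/
  ics : List (IC L)
  numPIC : ℕ
  /-- the probabilistic integrity constraints -/
  pic : Fin numPIC → PIC L

section Substitution

variable {L : FirstOrder.Language.{u, v}} {α β : Type}

def Atom.subst (a : Atom L α) (σ : α → L.Term β) : Atom L β :=
  ⟨a.pred, fun j => (a.args j).subst σ⟩

def Literal.subst (l : Literal L α) (σ : α → L.Term β) : Literal L β :=
  match l with
  | .pos a => .pos (a.subst σ)
  | .neg a => .neg (a.subst σ)

def substHead (H : Head L α) (σ : α → L.Term β) : Head L β :=
  H.map fun c => c.map fun l => l.subst σ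

/-- A variable renaming, seen as a substitution. -/
def ren (f : α → β) : α → L.Term β := fun x => .var (f x)

/-- Extend a substitution of existential variables (left) to terms that also contain
universal variables (right), which are left alone. -/
def liftE (σ : ℕ → L.Term ℕ) : ℕ ⊕ β → L.Term (ℕ ⊕ β) :=
  Sum.elim (fun x => (σ x).subst (ren Sum.inl)) (fun y => .var (Sum.inr y))

/-- The equations `N = N'` between the arguments of two atoms with the same predicate. -/
def argEqs (a b : Atom L α) (h : a.pred = b.pred) : List (L.Term α × L.Term α) :=
  List.ofFn fun j : Fin a.pred.1 => (a.args j, b.args (Fin.cast (congrArg Sigma.fst h) j))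

end Substitution

/-! ### Atomic choices -/

/-- An instance `ic_i θ` of a probabilistic integrity constraint, given by the index `i` and the
substitution `θ` for the variables of `ic_i`. -/
abbrev Inst {L : FirstOrder.Language.{u, v}} (P : Program L) (α : Type) :=
  Σ i : Fin P.numPIC, Fin (P.pic i).ic.nvars → L.Term α

def Inst.subst {L : FirstOrder.Language.{u, v}} {P : Program L} {α β : Type} (x : Inst P α)
    (σ : α → L.Term β) : Inst P β :=
  ⟨x.1, fun j => (x.2 j).subst σ⟩

/-- Atomic choices `(ic_i, θ, k)`, with `true` for `k = 1` and `false` for `k = 0`. The terms of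
`θ` may contain existential variables (left; shared with the rest of a node) and universal
variables (right). -/
abbrev AtomicChoice {L : FirstOrder.Language.{u, v}} (P : Program L) := Inst P (ℕ ⊕ ℕ) × Bool

/-- A composite choice is a consistent set of atomic choices. -/
def IsCompositeChoice {L : FirstOrder.Language.{u, v}} {P : Program L} (E : Set (AtomicChoice P)) : Prop :=
  ∀ x : Inst P (ℕ ⊕ ℕ), ¬ ((x, true) ∈ E ∧ (x, false) ∈ E)

def substChoices {L : FirstOrder.Language.{u, v}} {P : Program L} (σ : ℕ → L.Term ℕ)
    (E : Set (AtomicChoice P)) : Set (AtomicChoice P) :=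
  (fun x => (x.1.subst (liftE σ), x.2)) '' E

/-! ### Declarative semantics

The truth values are those of `SignType`: `1` is true, `0` is undefined, `-1` is false, with
strong Kleene connectives: negation `-`, conjunction `min`, disjunction `max`. -/

/-- A three-valued structure: functions and equality are two-valued (equality being identity),
predicates are three-valued. -/
structure Interp (L : FirstOrder.Language.{u, v}) where
  D : Type w
  fn : ∀ {n : ℕ}, L.Functions n → (Fin n → D) → D
  val : (Σ p : Pred L, Fin p.1 → D) → SignType

section Semantics

variable {L : FirstOrder.Language.{u, v}}

def Interp.eval (M : Interp.{u, v, w} L) {α : Type} (η : α → M.D) : L.Term α → M.D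
  | .var x => η x
  | .func f ts => M.fn f fun j => M.eval η (ts j)

/-- The predicate and the values of the arguments of an atom. -/
def Interp.ground (M : Interp.{u, v, w} L) {α : Type} (η : α → M.D) (a : Atom L α) :
    Σ p : Pred L, Fin p.1 → M.D :=
  ⟨a.pred, fun j => M.eval η (a.args j)⟩

def Interp.atomVal (M : Interp.{u, v, w} L) {α : Type} (η : α → M.D) (a : Atom L α) : SignType :=
  M.val (M.ground η a)

def Interp.litVal (M : Interp.{u, v, w} L) {α : Type} (η : α → M.D) : Literal L α → SignType
  | .pos a => M.atomVal η a
  | .neg a => - M.atomVal η a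

def conjVal (l : List SignType) : SignType := l.foldr min 1

def disjVal (l : List SignType) : SignType := l.foldr max (-1)

def Interp.litsVal (M : Interp.{u, v, w} L) {α : Type} (η : α → M.D) (c : List (Literal L α)) :
    SignType :=
  conjVal (c.map (M.litVal η))

def Interp.headVal (M : Interp.{u, v, w} L) {α : Type} (η : α → M.D) (H : Head L α) : SignType :=
  disjVal (H.map (M.litsVal η))

/-- The value of `Body → Head`, that is, of `¬ Body ∨ Head`. -/
def Interp.icVal (M : Interp.{u, v, w} L) (c : IC L) (η : Fin c.nvars → M.D) : SignType :=
  max (- conjVal (c.body.map (M.atomVal η))) (M.headVal η c.head)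

/-- Clark's equality theory. -/
structure Interp.CET (M : Interp.{u, v, w} L) : Prop where
  inj : ∀ {n : ℕ} (f : L.Functions n) (xs ys : Fin n → M.D), M.fn f xs = M.fn f ys → xs = ys
  disj : ∀ {m n : ℕ} (f : L.Functions m) (g : L.Functions n) (xs : Fin m → M.D)
    (ys : Fin n → M.D), (⟨m, f⟩ : Σ k, L.Functions k) ≠ ⟨n, g⟩ → M.fn f xs ≠ M.fn g ys
  occurs : ∀ (t : L.Term ℕ) (x : ℕ) (η : ℕ → M.D), x ∈ t.varFinset → t ≠ .var x →
    M.eval η t ≠ η x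

/-- The truth values of the instances, in `M`, of the right-hand sides of the completed definition
in `KB ∪ Δ` of a ground atom `q`. The variables of clauses range over all values; those of `Δ` are
interpreted by `v`. -/
def defVals (P : Program L) (Δ : Set (Atom L ℕ)) (M : Interp.{u, v, w} L) (v : ℕ → M.D)
    (q : Σ p : Pred L, Fin p.1 → M.D) : Set SignType :=
  {x | ∃ c ∈ P.kb, ∃ η : Fin c.nvars → M.D, M.ground η c.head = q ∧ x = M.litsVal η c.body} ∪
  {x | ∃ a ∈ Δ, M.ground v a = q ∧ x = 1}

/-- `M`, with the existential variables interpreted by `v`, is a three-valued model of the Clark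
completion of `KB ∪ Δ`: it satisfies Clark's equality theory and every ground atom has the same
truth value as the (possibly empty, possibly infinite) disjunction of its definitions. -/
def IsCompletionModel (P : Program L) (Δ : Set (Atom L ℕ)) (M : Interp.{u, v, w} L)
    (v : ℕ → M.D) : Prop :=
  M.CET ∧ ∀ q, IsLUB (defVals P Δ M v q) (M.val q)

/-- `KB ∪ Δ ⊨ Φ` in the three-valued completion semantics, for models with domains in `Type w`.
The variables of `Δ` are existential in the premise, and shared with `Φ`:
every `M` and `v` that satisfy the premise must satisfy `Φ`. -/
def Entails (P : Program L) (Δ : Set (Atom L ℕ))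
    (Φ : (M : Interp.{u, v, w} L) → (ℕ → M.D) → Prop) : Prop :=
  ∀ (M : Interp.{u, v, w} L) (v : ℕ → M.D), IsCompletionModel P Δ M v → Φ M v

/-- `(Δ, θ)` is a probabilistic abductive answer for the goal `G` in the explanation `E`. -/
structure IsProbAbductiveAnswer (P : Program L) (G : Goal L) (Δ : Set (Atom L ℕ))
    (θ : Fin G.nvars → L.Term ℕ) (E : Set (AtomicChoice P)) : Prop where
  abducible : ∀ a ∈ Δ, a.pred ∈ P.abd
  composite : IsCompositeChoice E
  goal : Entails.{u, v, w} P Δ fun M v => M.litsVal (fun x => M.eval v (θ x)) G.lits = 1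
  ics : ∀ c ∈ P.ics, Entails.{u, v, w} P Δ fun M _ => ∀ η : Fin c.nvars → M.D, M.icVal c η = 1
  choices : ∀ (i : Fin P.numPIC) (τ : Fin (P.pic i).ic.nvars → L.Term (ℕ ⊕ ℕ)),
    ((⟨i, τ⟩ : Inst P (ℕ ⊕ ℕ)), true) ∈ E →
      Entails.{u, v, w} P Δ fun M v => ∀ z : ℕ → M.D,
        M.icVal (P.pic i).ic (fun x => M.eval (Sum.elim v z) (τ x)) = 1

end Semantics

/-! ### Operational semantics -/

/-- A conjunct of the resolvent, over the existential variables `ℕ`. -/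
inductive ResItem (L : FirstOrder.Language.{u, v}) where
  | lit (l : Literal L ℕ)
  | eq (s t : L.Term ℕ)
  /-- the disequality `∀ y₁ … yₖ, s ≠ t` -/
  | neq (k : ℕ) (s t : L.Term (ℕ ⊕ Fin k))
  /-- a disjunction of conjunctions of literals; `disj []` is `false` -/
  | disj (H : Head L ℕ)

def ResItem.subst {L : FirstOrder.Language.{u, v}} (σ : ℕ → L.Term ℕ) : ResItem L → ResItem L
  | .lit l => .lit (l.subst σ)
  | .eq s t => .eq (s.subst σ) (t.subst σ)
  | .neq k s t => .neq k (s.subst (liftE σ)) (t.subst (liftE σ))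
  | .disj H => .disj (substHead H σ)

/-- A conjunct of the body of an implication. -/
inductive BodyItem (L : FirstOrder.Language.{u, v}) (α : Type) where
  | lit (l : Literal L α)
  | eq (s t : L.Term α)

def BodyItem.subst {L : FirstOrder.Language.{u, v}} {α β : Type} (σ : α → L.Term β) :
    BodyItem L α → BodyItem L β
  | .lit l => .lit (l.subst σ)
  | .eq s t => .eq (s.subst σ) (t.subst σ)

/-- An implication of a node: `∀ y₁ … yₖ, body → head`, possibly with free existential
variables (left). -/
structure Impl {L : FirstOrder.Language.{u, v}} (P : Program L) where
  /-- number of universally quantified variables -/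
  k : ℕ
  body : Multiset (BodyItem L (ℕ ⊕ Fin k))
  head : Head L (ℕ ⊕ Fin k)
  /-- `none` for a non-probabilistic constraint, the decoration `ic_i θ` for a probabilistic one -/
  deco : Option (Inst P (ℕ ⊕ Fin k))
  /-- the pairs (abduced atom, body atom) on which propagation has been applied already -/
  done : Set (Atom L ℕ × Atom L (ℕ ⊕ Fin k))

section Operational

variable {L : FirstOrder.Language.{u, v}} {P : Program L}

/-- Apply a substitution of existential variables to an implication. -/
def Impl.substE (σ : ℕ → L.Term ℕ) (I : Impl P) : Impl P where
  k := I.k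
  body := I.body.map (BodyItem.subst (liftE σ))
  head := substHead I.head (liftE σ)
  deco := I.deco.map fun x => x.subst (liftE σ)
  done := (fun x => (x.1.subst σ, x.2.subst (liftE σ))) '' I.done

/-- A new implication that arises from `I`: its body is `B`, and its head and decoration are those
of `I` under `σ`. -/
def Impl.derive (I : Impl P) (k : ℕ) (σ : ℕ ⊕ Fin I.k → L.Term (ℕ ⊕ Fin k))
    (B : Multiset (BodyItem L (ℕ ⊕ Fin k))) : Impl P where
  k := k
  body := B
  head := substHead I.head σ
  deco := I.deco.map fun x => x.subst σ
  done := ∅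

/-- `I` with body `B` instead. -/
def Impl.withBody (I : Impl P) (B : Multiset (BodyItem L (ℕ ⊕ Fin I.k))) : Impl P where
  k := I.k
  body := B
  head := I.head
  deco := I.deco
  done := ∅

open Classical in
/-- Unfolding the atom `a` of the body `a, B` of `I`: one implication for each clause whose head
has the predicate of `a`. The variables of the clause become new universal variables. -/
noncomputable def Impl.unfold (I : Impl P) (a : Atom L (ℕ ⊕ Fin I.k))
    (B : Multiset (BodyItem L (ℕ ⊕ Fin I.k))) : List (Impl P) :=
  P.kb.filterMap fun (c : Clause L) =>
    if h : a.pred = c.head.pred then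
      let old : ℕ ⊕ Fin I.k → L.Term (ℕ ⊕ Fin (I.k + c.nvars)) :=
        ren (Sum.map id (Fin.castAdd c.nvars))
      let new : Fin c.nvars → L.Term (ℕ ⊕ Fin (I.k + c.nvars)) :=
        ren (Sum.inr ∘ Fin.natAdd I.k)
      some (I.derive (I.k + c.nvars) old
        (((argEqs (a.subst old) (c.head.subst new) h).map fun e => BodyItem.eq e.1 e.2) +
          ((c.body.map fun l => BodyItem.lit (l.subst new) : List _) +
            B.map (BodyItem.subst old))))
    else none

/-- The substitution `{x / t}`. -/
def single {α : Type} [DecidableEq α] (x : α) (t : L.Term α) : α → L.Term α :=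
  Function.update (fun y => .var y) x t

/-- The equation `s = t` is `x = r`, up to orientation. -/
def IsVarEq {α : Type} (s t : L.Term α) (x : α) (r : L.Term α) : Prop :=
  (s = .var x ∧ t = r) ∨ (t = .var x ∧ s = r)

/-- The terms start with different function symbols. -/
def Clash {α : Type} (s t : L.Term α) : Prop :=
  ∃ (m n : ℕ) (f : L.Functions m) (g : L.Functions n) (ss : Fin m → L.Term α)
    (ts : Fin n → L.Term α), s = .func f ss ∧ t = .func g ts ∧
      (⟨m, f⟩ : Σ k, L.Functions k) ≠ ⟨n, g⟩

/-- The substitution that makes the universal variables occurring in `t` existential, with the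
names `n, n + 1, …`. -/
def makeExistential {k : ℕ} (n : ℕ) (t : L.Term (ℕ ⊕ Fin k)) :
    ℕ ⊕ Fin k → L.Term (ℕ ⊕ Fin k) :=
  Sum.elim (fun x => .var (Sum.inl x))
    (fun y => if Sum.inr y ∈ t.varFinset then .var (Sum.inl (n + y)) else .var (Sum.inr y))

/-- Replace every universal variable by an existential one with the names `n, n + 1, …`. -/
def lower {k : ℕ} (n : ℕ) : ℕ ⊕ Fin k → L.Term ℕ :=
  ren (Sum.elim id fun y => n + y)

/-- A node `⟨R, Δ, PSIC, E, θ⟩` of a derivation for a goal with `g` variables, together with the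
first unused name of an existential variable and the pairs of abduced atoms on which factoring has
been applied already. -/
structure Node (P : Program L) (g : ℕ) where
  R : Multiset (ResItem L)
  Δ : Set (Atom L ℕ)
  PSIC : Multiset (Impl P)
  E : Set (AtomicChoice P)
  θ : Fin g → L.Term ℕ
  next : ℕ
  factored : Set (Atom L ℕ × Atom L ℕ)

/-- Apply a substitution of existential variables to a node. -/
def Node.subst {g : ℕ} (σ : ℕ → L.Term ℕ) (N : Node P g) : Node P g where
  R := N.R.map (ResItem.subst σ)
  Δ := (fun a => a.subst σ) '' N.Δ
  PSIC := N.PSIC.map (Impl.substE σ)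
  E := substChoices σ N.E
  θ := fun x => (N.θ x).subst σ
  next := N.next
  factored := (fun x => (x.1.subst σ, x.2.subst σ)) '' N.factored

/-- The transitions. -/
inductive Step {g : ℕ} : Node P g → Node P g → Prop
  -- Literals of the resolvent
  /-- an abducible atom of the goal is abduced -/
  | abduce {N : Node P g} {R a} (hR : N.R = .lit (.pos a) ::ₘ R) (ha : a.pred ∈ P.abd) :
      Step N { N with R := R, Δ := insert a N.Δ }
  /-- `¬ a` is replaced by `a → false` -/
  | negation {N : Node P g} {R a} (hR : N.R = .lit (.neg a) ::ₘ R) :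
      Step N { N with
        R := R
        PSIC := ⟨0, {.lit (.pos (a.subst (ren Sum.inl)))}, [], none, ∅⟩ ::ₘ N.PSIC }
  /-- unfolding in the resolvent; the variables of the clause become new existential variables -/
  | unfoldGoal {N : Node P g} {R a} (hR : N.R = .lit (.pos a) ::ₘ R) (ha : a.pred ∉ P.abd)
      (c : Clause L) (hc : c ∈ P.kb) (h : a.pred = c.head.pred) :
      Step N { N with
        R := ((argEqs a (c.head.subst (ren fun y => N.next + y)) h).map
            fun e => ResItem.eq e.1 e.2) +
          ((c.body.map fun l => ResItem.lit (l.subst (ren fun y => N.next + y)) : List _) + R)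
        next := N.next + c.nvars }
  /-- splitting of a disjunction -/
  | split {N : Node P g} {R H} (hR : N.R = .disj H ::ₘ R) (c : List (Literal L ℕ)) (hc : c ∈ H) :
      Step N { N with R := (c.map ResItem.lit : List _) + R }
  -- Equality rewriting in the resolvent
  | eqDecompose {N : Node P g} {R n} {f : L.Functions n} {ss ts : Fin n → L.Term ℕ}
      (hR : N.R = .eq (.func f ss) (.func f ts) ::ₘ R) :
      Step N { N with R := (List.ofFn fun j => ResItem.eq (ss j) (ts j) : List _) + R }
  | eqClash {N : Node P g} {R s t} (hR : N.R = .eq s t ::ₘ R) (h : Clash s t) :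
      Step N { N with R := .disj [] ::ₘ R }
  | eqRefl {N : Node P g} {R x} (hR : N.R = .eq (.var x) (.var x) ::ₘ R) :
      Step N { N with R := R }
  | eqOccurs {N : Node P g} {R s t x r} (hR : N.R = .eq s t ::ₘ R) (h : IsVarEq s t x r)
      (hx : x ∈ r.varFinset) (hr : r ≠ .var x) :
      Step N { N with R := .disj [] ::ₘ R }
  /-- the substitution `{x / r}` is applied to the node, unless that would identify two instances
  on which opposite choices have been made -/
  | eqSubst {N : Node P g} {R s t x r} (hR : N.R = .eq s t ::ₘ R) (h : IsVarEq s t x r)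
      (hx : x ∉ r.varFinset) (hE : IsCompositeChoice (substChoices (single x r) N.E)) :
      Step N (Node.subst (single x r) { N with R := R })
  -- Disequality rewriting in the resolvent
  /-- `f(s₁, …, sₙ) ≠ f(t₁, …, tₙ)` is replaced by `s₁ ≠ t₁ ∨ … ∨ sₙ ≠ tₙ`, which is split -/
  | neqDecompose {N : Node P g} {R k n} {f : L.Functions n} {ss ts : Fin n → L.Term (ℕ ⊕ Fin k)}
      (hR : N.R = .neq k (.func f ss) (.func f ts) ::ₘ R) (j : Fin n) :
      Step N { N with R := .neq k (ss j) (ts j) ::ₘ R }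
  | neqClash {N : Node P g} {R k s t} (hR : N.R = .neq k s t ::ₘ R) (h : Clash s t) :
      Step N { N with R := R }
  | neqRefl {N : Node P g} {R k x} (hR : N.R = .neq k (.var x) (.var x) ::ₘ R) :
      Step N { N with R := .disj [] ::ₘ R }
  | neqOccurs {N : Node P g} {R k s t x r} (hR : N.R = .neq k s t ::ₘ R) (h : IsVarEq s t x r)
      (hx : x ∈ r.varFinset) (hr : r ≠ .var x) :
      Step N { N with R := R }
  /-- `∀ y, y ≠ r` is false -/
  | neqUniversal {N : Node P g} {R k s t y r} (hR : N.R = .neq k s t ::ₘ R)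
      (h : IsVarEq s t (Sum.inr y) r) (hy : Sum.inr y ∉ r.varFinset) :
      Step N { N with R := .disj [] ::ₘ R }
  -- Factoring
  | factorEq {N : Node P g} {a b : Atom L ℕ} (ha : a ∈ N.Δ) (hb : b ∈ N.Δ) (hab : a ≠ b)
      (h₁ : (a, b) ∉ N.factored) (h₂ : (b, a) ∉ N.factored) (h : a.pred = b.pred) :
      Step N { N with
        R := ((argEqs a b h).map fun e => ResItem.eq e.1 e.2 : List _) + N.R
        factored := insert (a, b) N.factored }
  /-- the disequality of the argument tuples is a disjunction, which is split -/
  | factorNeq {N : Node P g} {a b : Atom L ℕ} (ha : a ∈ N.Δ) (hb : b ∈ N.Δ) (hab : a ≠ b)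
      (h₁ : (a, b) ∉ N.factored) (h₂ : (b, a) ∉ N.factored) (h : a.pred = b.pred)
      (s t : L.Term ℕ) (hst : (s, t) ∈ argEqs a b h) :
      Step N { N with
        R := .neq 0 (s.subst (ren Sum.inl)) (t.subst (ren Sum.inl)) ::ₘ N.R
        factored := insert (a, b) N.factored }
  -- Propagation and unfolding in implications
  /-- the implication `a(N'), B → H` is kept, and `N = N', B → H` is added -/
  | propagate {N : Node P g} {I J} (hI : N.PSIC = I ::ₘ J) {a : Atom L ℕ} (ha : a ∈ N.Δ)
      {b : Atom L (ℕ ⊕ Fin I.k)} {B} (hB : I.body = .lit (.pos b) ::ₘ B) (hb : b.pred ∈ P.abd)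
      (hd : (a, b) ∉ I.done) (h : a.pred = b.pred) :
      Step N { N with
        PSIC := { I with done := insert (a, b) I.done } ::ₘ
          I.withBody (((argEqs (a.subst (ren Sum.inl)) b h).map
            fun e => BodyItem.eq e.1 e.2 : List _) + B) ::ₘ J }
  | unfoldBody {N : Node P g} {I J} (hI : N.PSIC = I ::ₘ J) {a : Atom L (ℕ ⊕ Fin I.k)} {B}
      (hB : I.body = .lit (.pos a) ::ₘ B) (ha : a.pred ∉ P.abd) :
      Step N { N with PSIC := (I.unfold a B : Multiset (Impl P)) + J }
  -- Equality rewriting in the body of an implication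
  | bodyDecompose {N : Node P g} {I J} (hI : N.PSIC = I ::ₘ J) {n} {f : L.Functions n}
      {ss ts : Fin n → L.Term (ℕ ⊕ Fin I.k)} {B}
      (hB : I.body = .eq (.func f ss) (.func f ts) ::ₘ B) :
      Step N { N with
        PSIC := I.withBody ((List.ofFn fun j => BodyItem.eq (ss j) (ts j) : List _) + B) ::ₘ J }
  /-- `false → A` is `true` -/
  | bodyClash {N : Node P g} {I J} (hI : N.PSIC = I ::ₘ J) {s t : L.Term (ℕ ⊕ Fin I.k)} {B}
      (hB : I.body = .eq s t ::ₘ B) (h : Clash s t) :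
      Step N { N with PSIC := J }
  | bodyRefl {N : Node P g} {I J} (hI : N.PSIC = I ::ₘ J) {x : ℕ ⊕ Fin I.k} {B}
      (hB : I.body = .eq (.var x) (.var x) ::ₘ B) :
      Step N { N with PSIC := I.withBody B ::ₘ J }
  | bodyOccurs {N : Node P g} {I J} (hI : N.PSIC = I ::ₘ J) {s t : L.Term (ℕ ⊕ Fin I.k)} {B x r}
      (hB : I.body = .eq s t ::ₘ B) (h : IsVarEq s t x r) (hx : x ∈ r.varFinset)
      (hr : r ≠ .var x) :
      Step N { N with PSIC := J }
  /-- a universal variable is replaced throughout the implication -/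
  | bodySubst {N : Node P g} {I J} (hI : N.PSIC = I ::ₘ J) {s t : L.Term (ℕ ⊕ Fin I.k)} {B y r}
      (hB : I.body = .eq s t ::ₘ B) (h : IsVarEq s t (Sum.inr y) r)
      (hy : Sum.inr y ∉ r.varFinset) :
      Step N { N with
        PSIC := I.derive I.k (single (Sum.inr y) r)
          (B.map (BodyItem.subst (single (Sum.inr y) r))) ::ₘ J }
  -- Case analysis, for `x = r` with `x` existential and `r` not a universal variable
  /-- the universal variables that occur in `r` become new existential variables -/
  | caseEq {N : Node P g} {I J} (hI : N.PSIC = I ::ₘ J) {s t : L.Term (ℕ ⊕ Fin I.k)} {B x r}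
      (hB : I.body = .eq s t ::ₘ B) (h : IsVarEq s t (Sum.inl x) r)
      (hx : Sum.inl x ∉ r.varFinset) (hr : ∀ y, r ≠ .var (Sum.inr y)) :
      Step N { N with
        R := .eq (.var x) (r.subst (lower N.next)) ::ₘ N.R
        PSIC := I.derive I.k (makeExistential N.next r)
          (B.map (BodyItem.subst (makeExistential N.next r))) ::ₘ J
        next := N.next + I.k }
  | caseNeq {N : Node P g} {I J} (hI : N.PSIC = I ::ₘ J) {s t : L.Term (ℕ ⊕ Fin I.k)} {B x r}
      (hB : I.body = .eq s t ::ₘ B) (h : IsVarEq s t (Sum.inl x) r)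
      (hx : Sum.inl x ∉ r.varFinset) (hr : ∀ y, r ≠ .var (Sum.inr y)) :
      Step N { N with R := .neq I.k (.var (Sum.inl x)) r ::ₘ N.R, PSIC := J }
  -- Negative literals in the body of an implication: once only negative literals are left,
  -- `¬ a, B → H` is rewritten to `a ∨ (B → H)`, which is split
  | negLeft {N : Node P g} {I J} (hI : N.PSIC = I ::ₘ J) {a : Atom L (ℕ ⊕ Fin I.k)} {B}
      (hB : I.body = .lit (.neg a) ::ₘ B) (hneg : ∀ b ∈ B, ∃ a', b = .lit (.neg a'))
      (a₀ : Atom L ℕ) (ha : a = a₀.subst (ren Sum.inl)) :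
      Step N { N with R := .lit (.pos a₀) ::ₘ N.R, PSIC := J }
  | negRight {N : Node P g} {I J} (hI : N.PSIC = I ::ₘ J) {a : Atom L (ℕ ⊕ Fin I.k)} {B}
      (hB : I.body = .lit (.neg a) ::ₘ B) (hneg : ∀ b ∈ B, ∃ a', b = .lit (.neg a')) :
      Step N { N with PSIC := I.withBody B ::ₘ J }
  -- Logical equivalence `true → A`, for `A` without universal variables
  | impliesHead {N : Node P g} {I J} (hI : N.PSIC = I ::ₘ J) (hB : I.body = 0)
      (hd : I.deco = none) (H : Head L ℕ) (hH : I.head = substHead H (ren Sum.inl)) :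
      Step N { N with R := .disj H ::ₘ N.R, PSIC := J }
  /-- the instance is chosen, and its consequence is added -/
  | choose {N : Node P g} {I J} (hI : N.PSIC = I ::ₘ J) (hB : I.body = 0) {d}
      (hd : I.deco = some d) (H : Head L ℕ) (hH : I.head = substHead H (ren Sum.inl))
      (hE : (d.subst (ren (Sum.map id Fin.val)), false) ∉ N.E) :
      Step N { N with
        R := .disj H ::ₘ N.R
        PSIC := J
        E := insert (d.subst (ren (Sum.map id Fin.val)), true) N.E }
  /-- the instance is not chosen -/
  | discard {N : Node P g} {I J} (hI : N.PSIC = I ::ₘ J) (hB : I.body = 0) {d}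
      (hd : I.deco = some d) (hE : (d.subst (ren (Sum.map id Fin.val)), true) ∉ N.E) :
      Step N { N with
        PSIC := J
        E := insert (d.subst (ren (Sum.map id Fin.val)), false) N.E }
  /-- floundering: a head with a universal variable cannot become part of the resolvent, and the
  branch fails -/
  | flounder {N : Node P g} {I J} (hI : N.PSIC = I ::ₘ J) (hB : I.body = 0)
      (hH : ¬ ∃ H : Head L ℕ, I.head = substHead H (ren Sum.inl)) :
      Step N { N with R := .disj [] ::ₘ N.R, PSIC := J }

/-- A non-probabilistic constraint as an implication of a node. -/
def IC.toImpl (P : Program L) (c : IC L) : Impl P where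
  k := c.nvars
  body := Multiset.ofList (c.body.map fun a => BodyItem.lit (.pos (a.subst (ren Sum.inr))))
  head := substHead c.head (ren Sum.inr)
  deco := none
  done := ∅

/-- A probabilistic constraint as an implication of a node, decorated with itself and the initial
substitution. -/
def picImpl (P : Program L) (i : Fin P.numPIC) : Impl P where
  k := (P.pic i).ic.nvars
  body := Multiset.ofList
    ((P.pic i).ic.body.map fun a => BodyItem.lit (.pos (a.subst (ren Sum.inr))))
  head := substHead (P.pic i).ic.head (ren Sum.inr)
  deco := some ⟨i, ren Sum.inr⟩
  done := ∅

/-- The initial node `⟨G, ∅, IC, ∅, ∅⟩`. The variables of the goal are the existential variables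
`0, …, G.nvars - 1`. -/
def initialNode (P : Program L) (G : Goal L) : Node P G.nvars where
  R := (G.lits.map fun l => ResItem.lit (l.subst (ren Fin.val)) : List _)
  Δ := ∅
  PSIC := (P.ics.map (IC.toImpl P) ++ List.ofFn (picImpl P) : List _)
  E := ∅
  θ := ren Fin.val
  next := G.nvars
  factored := ∅

/-- There is a successful derivation for `G` with abduced set `Δ`, explanation `E` and
substitution `θ`: it leads from the initial node to a node with empty resolvent to which no
transition is applicable. -/
def SuccessfulDerivation (P : Program L) (G : Goal L) (Δ : Set (Atom L ℕ))
    (θ : Fin G.nvars → L.Term ℕ) (E : Set (AtomicChoice P)) : Prop :=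
  ∃ N : Node P G.nvars, Relation.ReflTransGen Step (initialNode P G) N ∧
    (∀ N', ¬ Step N N') ∧ N.R = 0 ∧ N.Δ = Δ ∧ N.θ = θ ∧ N.E = E

end Operational

end ProbIFF

/-!
The proof reads a derivation backwards. A model `M` of the completion of `KB ∪ Δ`, in which the
existential variables of the final node have values `v`, is fixed. From a node that is true in `M`,
values of the existential variables that make the preceding node true are recovered
(`Step.exists_holds`): they are the old values, except that a transition which applies a
substitution `σ` to the node requires a variable `x` to have the value of `σ x`. So truth of the
final node is carried back to the initial node, where it says that the goal and the
non-probabilistic constraints are true; the answer substitution keeps its values on the way.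

Three points need care.

* Propagation keeps the implication it is applied to, and such an implication is still there in the
  final node. It is not obviously true: its truth is what the implications added by propagation
  contribute. Hence truth of an implication (`Impl.Holds`) makes an exception for the values of the
  universal variables at which a pair that has been propagated coincides. In the final node, an
  implication that is not probabilistic is stuck at an abducible atom on which propagation has been
  exhausted (`exists_propagated_atom`); as abducible atoms are either abduced or false, it holds in
  this sense (`Node.holds_of_final`). Going back over a propagation removes one pair from the
  exception (`Impl.Holds.of_propagate`), and at the initial node there is none.
* Case analysis `x = r` turns universal variables of `r` into existential ones. By Clark's equality
  theory at most one choice of their values satisfies `x = r`, so that the implication holds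
  vacuously for all others (`Interp.CET.eval_makeExistential`).
* Probabilistic implications may be discarded, and then need not be true. But the head of a
  probabilistic implication is always the head of the instance that decorates it
  (`Impl.HeadMatchesDeco`), and when an instance is chosen this head becomes part of the resolvent.
  So it is true, and with it the instance (`Node.ChosenHold`).
-/

namespace ProbIFF

variable {L : FirstOrder.Language.{u, v}}

/-! ### Evaluation and substitution -/

section Evaluation

variable {α β γ : Type} (M : Interp.{u, v, w} L)

theorem Interp.eval_subst (η : β → M.D) (σ : α → L.Term β) (t : L.Term α) :
    M.eval η (t.subst σ) = M.eval (fun x => M.eval η (σ x)) t := by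
  induction t with
  | var x => rfl
  | func f ts ih => simp only [FirstOrder.Language.Term.subst, Interp.eval, ih]

theorem Interp.ground_subst (η : β → M.D) (σ : α → L.Term β) (a : Atom L α) :
    M.ground η (a.subst σ) = M.ground (fun x => M.eval η (σ x)) a := by
  simp only [Interp.ground, Atom.subst, Interp.eval_subst]

theorem Interp.atomVal_subst (η : β → M.D) (σ : α → L.Term β) (a : Atom L α) :
    M.atomVal η (a.subst σ) = M.atomVal (fun x => M.eval η (σ x)) a := by
  rw [Interp.atomVal, Interp.ground_subst, Interp.atomVal]

theorem Interp.litVal_subst (η : β → M.D) (σ : α → L.Term β) (l : Literal L α) :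
    M.litVal η (l.subst σ) = M.litVal (fun x => M.eval η (σ x)) l := by
  cases l <;> simp only [Literal.subst, Interp.litVal, Interp.atomVal_subst]

theorem Interp.headVal_subst (η : β → M.D) (σ : α → L.Term β) (H : Head L α) :
    M.headVal η (substHead H σ) = M.headVal (fun x => M.eval η (σ x)) H := by
  simp only [Interp.headVal, substHead, List.map_map]
  congr 1
  refine List.map_congr_left fun c _ => ?_
  simp only [Function.comp_apply, Interp.litsVal, List.map_map]
  congr 1
  exact List.map_congr_left fun l _ => M.litVal_subst η σ l

theorem term_subst_subst (σ : α → L.Term β) (τ : β → L.Term γ) (t : L.Term α) :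
    (t.subst σ).subst τ = t.subst fun x => (σ x).subst τ := by
  induction t with
  | var x => rfl
  | func f ts ih => simp only [FirstOrder.Language.Term.subst, ih]

theorem substHead_substHead (σ : α → L.Term β) (τ : β → L.Term γ) (H : Head L α) :
    substHead (substHead H σ) τ = substHead H fun x => (σ x).subst τ := by
  simp only [substHead, List.map_map]
  refine List.map_congr_left fun c _ => ?_
  simp only [Function.comp_apply, List.map_map]
  refine List.map_congr_left fun l _ => ?_
  cases l <;> simp [Literal.subst, Atom.subst, term_subst_subst]

theorem Interp.eval_congr [DecidableEq α] {η η' : α → M.D} (t : L.Term α)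
    (h : ∀ x ∈ t.varFinset, η x = η' x) : M.eval η t = M.eval η' t := by
  induction t with
  | var x => exact h x (by simp [FirstOrder.Language.Term.varFinset])
  | func f ts ih =>
    simp only [Interp.eval]
    congr 1
    funext j
    exact ih j fun x hx => h x (Finset.mem_biUnion.2 ⟨j, Finset.mem_univ _, hx⟩)

theorem Interp.eval_liftE (v : ℕ → M.D) (z : β → M.D) (σ : ℕ → L.Term ℕ) :
    (fun x => M.eval (Sum.elim v z) (liftE σ x)) = Sum.elim (fun x => M.eval v (σ x)) z := by
  funext x
  cases x with
  | inl x => simp [liftE, Interp.eval_subst, ren, Interp.eval]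
  | inr y => rfl

theorem Interp.eval_single [DecidableEq α] (η : α → M.D) {x : α} {t : L.Term α}
    (h : η x = M.eval η t) : (fun y => M.eval η (single x t y)) = η := by
  funext y
  by_cases hy : y = x
  · subst hy; simp [single, h]
  · simp [single, hy, Interp.eval]

end Evaluation

/-! ### Consequences of Clark's equality theory -/

section Equality

variable {α : Type} {M : Interp.{u, v, w} L}

theorem Interp.CET.eval_func_eq_iff (hM : M.CET) (η : α → M.D) {n : ℕ} (f : L.Functions n)
    (ss ts : Fin n → L.Term α) :
    M.eval η (.func f ss) = M.eval η (.func f ts) ↔ ∀ j, M.eval η (ss j) = M.eval η (ts j) := by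
  simp only [Interp.eval]
  exact ⟨fun h => congrFun (hM.inj f _ _ h), fun h => congrArg _ (funext h)⟩

theorem Interp.CET.eval_ne_of_clash (hM : M.CET) (η : α → M.D) {s t : L.Term α}
    (h : Clash s t) : M.eval η s ≠ M.eval η t := by
  obtain ⟨m, n, f, g, ss, ts, rfl, rfl, hfg⟩ := h
  exact hM.disj f g _ _ hfg

/-- Terms with the same value have the same values of all their variables: the structure satisfies
the injectivity axioms. -/
theorem Interp.CET.eq_of_eval_eq [DecidableEq α] (hM : M.CET) {η η' : α → M.D} (t : L.Term α)
    (h : M.eval η t = M.eval η' t) : ∀ x ∈ t.varFinset, η x = η' x := by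
  induction t with
  | var y =>
    intro x hx
    obtain rfl : x = y := by simpa [FirstOrder.Language.Term.varFinset] using hx
    exact h
  | func f ts ih =>
    intro x hx
    obtain ⟨j, -, hj⟩ := Finset.mem_biUnion.1 hx
    exact ih j (congrFun (hM.inj f _ _ h) j) x hj

theorem mem_varFinset_subst_ren {β : Type} [DecidableEq α] [DecidableEq β] (f : α → β)
    {x : α} (t : L.Term α) (h : x ∈ t.varFinset) : f x ∈ (t.subst (ren f)).varFinset := by
  induction t with
  | var y =>
    obtain rfl : x = y := by simpa [FirstOrder.Language.Term.varFinset] using h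
    simp [FirstOrder.Language.Term.subst, ren, FirstOrder.Language.Term.varFinset]
  | func g ts ih =>
    obtain ⟨j, -, hj⟩ := Finset.mem_biUnion.1 h
    exact Finset.mem_biUnion.2 ⟨j, Finset.mem_univ _, ih j hj⟩

/-- The occurs check for terms over any countable type of variables. -/
theorem Interp.CET.eval_ne_of_occurs [DecidableEq α] [Countable α] (hM : M.CET) (η : α → M.D)
    {x : α} {t : L.Term α} (hx : x ∈ t.varFinset) (ht : t ≠ .var x) : M.eval η t ≠ η x := by
  obtain ⟨f, hf⟩ := exists_injective_nat α
  have : Nonempty α := ⟨x⟩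
  have hinv := Function.leftInverse_invFun hf
  have key := hM.occurs (t.subst (ren f)) (f x) (η ∘ Function.invFun f)
    (mem_varFinset_subst_ren f t hx) (by
      intro h
      cases t with
      | var y =>
        injection h with h
        exact ht (congrArg _ (hf h))
      | func g ts => cases h)
  simpa [Interp.eval_subst, ren, Interp.eval, hinv _] using key

theorem IsVarEq.eval_eq_iff {s t r : L.Term α} {x : α} (h : IsVarEq s t x r) (η : α → M.D) :
    M.eval η s = M.eval η t ↔ η x = M.eval η r := by
  rcases h with ⟨rfl, rfl⟩ | ⟨rfl, rfl⟩
  · rfl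
  · exact eq_comm

theorem forall_argEqs_iff (η : α → M.D) (a b : Atom L α) (h : a.pred = b.pred) :
    (∀ e ∈ argEqs a b h, M.eval η e.1 = M.eval η e.2) ↔ M.ground η a = M.ground η b := by
  obtain ⟨p, s⟩ := a
  obtain ⟨q, t⟩ := b
  dsimp only at h
  subst h
  simp only [argEqs, Interp.ground, List.forall_mem_ofFn_iff, Sigma.mk.injEq, heq_eq_eq, true_and]
  exact ⟨funext, congrFun⟩

end Equality

/-! ### Truth values -/

section TruthValues

theorem conjVal_eq_one_iff (l : List SignType) : conjVal l = 1 ↔ ∀ x ∈ l, x = 1 := by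
  induction l with
  | nil => simp [conjVal]
  | cons a l ih =>
    have : min a (conjVal l) = 1 ↔ a = 1 ∧ conjVal l = 1 := by
      generalize conjVal l = b; revert a b; decide
    change min a (conjVal l) = _ ↔ _
    simp only [this, ih, List.forall_mem_cons]

theorem conjVal_eq_neg_one_iff (l : List SignType) : conjVal l = -1 ↔ ∃ x ∈ l, x = -1 := by
  induction l with
  | nil => simp [conjVal]
  | cons a l ih =>
    have : min a (conjVal l) = -1 ↔ a = -1 ∨ conjVal l = -1 := by
      generalize conjVal l = b; revert a b; decide
    change min a (conjVal l) = _ ↔ _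
    simp only [this, ih, List.exists_mem_cons_iff]

theorem disjVal_eq_one_iff (l : List SignType) : disjVal l = 1 ↔ ∃ x ∈ l, x = 1 := by
  induction l with
  | nil => simp [disjVal]
  | cons a l ih =>
    have : max a (disjVal l) = 1 ↔ a = 1 ∨ disjVal l = 1 := by
      generalize disjVal l = b; revert a b; decide
    change max a (disjVal l) = _ ↔ _
    simp only [this, ih, List.exists_mem_cons_iff]

variable {α : Type} (M : Interp.{u, v, w} L) (η : α → M.D)

theorem Interp.litsVal_eq_one_iff (c : List (Literal L α)) :
    M.litsVal η c = 1 ↔ ∀ l ∈ c, M.litVal η l = 1 := by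
  simp [Interp.litsVal, conjVal_eq_one_iff]

theorem Interp.litsVal_eq_neg_one_iff (c : List (Literal L α)) :
    M.litsVal η c = -1 ↔ ∃ l ∈ c, M.litVal η l = -1 := by
  simp [Interp.litsVal, conjVal_eq_neg_one_iff]

theorem Interp.headVal_eq_one_iff (H : Head L α) :
    M.headVal η H = 1 ↔ ∃ c ∈ H, M.litsVal η c = 1 := by
  simp [Interp.headVal, disjVal_eq_one_iff]

theorem Interp.headVal_nil_ne_one : M.headVal η [] ≠ 1 := by
  simp [Interp.headVal_eq_one_iff]

theorem Interp.icVal_eq_one_iff (c : IC L) (η : Fin c.nvars → M.D) :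
    M.icVal c η = 1 ↔ (∃ a ∈ c.body, M.atomVal η a = -1) ∨ M.headVal η c.head = 1 := by
  have : ∀ a b : SignType, max (-a) b = 1 ↔ a = -1 ∨ b = 1 := by decide
  simp [Interp.icVal, this, conjVal_eq_neg_one_iff]

end TruthValues

/-! ### Models of the program -/

section KBModels

/-- The part of being a completion model that does not mention the abduced atoms: Clark's equality
theory, and the completed definitions of the predicates that are not abducible. -/
def IsKBModel (P : Program L) (M : Interp.{u, v, w} L) : Prop :=
  M.CET ∧ ∀ q : Σ p : Pred L, Fin p.1 → M.D, q.1 ∉ P.abd →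
    IsLUB {x | ∃ c ∈ P.kb, ∃ η : Fin c.nvars → M.D,
      M.ground η c.head = q ∧ x = M.litsVal η c.body} (M.val q)

variable {P : Program L} {Δ : Set (Atom L ℕ)} {M : Interp.{u, v, w} L} {v : ℕ → M.D}

theorem IsCompletionModel.isKBModel (hM : IsCompletionModel P Δ M v)
    (hΔ : ∀ a ∈ Δ, a.pred ∈ P.abd) : IsKBModel P M := by
  refine ⟨hM.1, fun q hq => ?_⟩
  have hempty : {x : SignType | ∃ a ∈ Δ, M.ground v a = q ∧ x = 1} = ∅ := by
    rw [Set.eq_empty_iff_forall_notMem]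
    rintro x ⟨a, ha, rfl, -⟩
    exact hq (hΔ a ha)
  simpa only [defVals, hempty, Set.union_empty] using hM.2 q

theorem IsCompletionModel.atomVal_eq_one_of_mem (hM : IsCompletionModel P Δ M v) {a : Atom L ℕ}
    (ha : a ∈ Δ) : M.atomVal v a = 1 := by
  have h : (1 : SignType) ≤ M.atomVal v a := (hM.2 _).1 (Or.inr ⟨a, ha, rfl, rfl⟩)
  exact le_antisymm (by generalize M.atomVal v a = b; revert b; decide) h

/-- Closed world for abducible predicates: no clause defines them, so that an instance which is
not abduced is false, and not merely undefined. -/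
theorem IsCompletionModel.val_eq_neg_one_of_abducible (hM : IsCompletionModel P Δ M v)
    {q : Σ p : Pred L, Fin p.1 → M.D} (hq : q.1 ∈ P.abd) (h : ∀ a ∈ Δ, M.ground v a ≠ q) :
    M.val q = -1 := by
  have : M.val q ≤ -1 := by
    refine (hM.2 q).2 ?_
    rintro x (⟨c, hc, η, rfl, -⟩ | ⟨a, ha, hq', -⟩)
    · exact absurd hq (P.kb_head c hc)
    · exact absurd hq' (h a ha)
  exact le_antisymm this (by generalize M.val q = b; revert b; decide)

theorem IsKBModel.val_eq_one_of_clause (hM : IsKBModel P M) {c : Clause L}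
    (hc : c ∈ P.kb) (η : Fin c.nvars → M.D) (h : M.litsVal η c.body = 1) :
    M.val (M.ground η c.head) = 1 := by
  have h : (1 : SignType) ≤ M.val (M.ground η c.head) :=
    (hM.2 _ (P.kb_head c hc)).1 ⟨c, hc, η, rfl, h.symm⟩
  exact le_antisymm (by generalize M.val _ = b; revert b; decide) h

theorem IsKBModel.val_eq_neg_one (hM : IsKBModel P M)
    {q : Σ p : Pred L, Fin p.1 → M.D} (hq : q.1 ∉ P.abd)
    (h : ∀ c ∈ P.kb, ∀ η : Fin c.nvars → M.D, M.ground η c.head = q → M.litsVal η c.body = -1) :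
    M.val q = -1 := by
  have : M.val q ≤ -1 := by
    refine (hM.2 q hq).2 ?_
    rintro x ⟨c, hc, η, hq', rfl⟩
    exact (h c hc η hq').le
  exact le_antisymm this (by generalize M.val q = b; revert b; decide)

end KBModels

/-! ### Truth of nodes -/

section Truth

variable {P : Program L} {g : ℕ} {α β : Type} (M : Interp.{u, v, w} L)

/-- A conjunct of the resolvent is true when the existential variables have the values `v`. -/
def ResItem.Holds (v : ℕ → M.D) : ResItem L → Prop
  | .lit l => M.litVal v l = 1
  | .eq s t => M.eval v s = M.eval v t
  | .neq k s t => ∀ z : Fin k → M.D, M.eval (Sum.elim v z) s ≠ M.eval (Sum.elim v z) t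
  | .disj H => M.headVal v H = 1

/-- A conjunct of the body of an implication is false (as opposed to undefined). -/
def BodyItem.IsFalse (η : α → M.D) : BodyItem L α → Prop
  | .lit l => M.litVal η l = -1
  | .eq s t => M.eval η s ≠ M.eval η t

/-- An implication is true when the existential variables have the values `v`, except that nothing
is claimed for the values of its universal variables at which some pair of an abduced atom and a
body atom coincides on which propagation has been applied: those are the business of the implication
that propagation has added. -/
def Impl.Holds (v : ℕ → M.D) (I : Impl P) : Prop :=
  ∀ z : Fin I.k → M.D, (∃ b ∈ I.body, b.IsFalse M (Sum.elim v z)) ∨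
    M.headVal (Sum.elim v z) I.head = 1 ∨
    ∃ e ∈ I.done, M.ground v e.1 = M.ground (Sum.elim v z) e.2

/-- The resolvent, the abduced atoms and the non-probabilistic implications of a node are true.
Probabilistic implications are left out: discarding one does not make it true. -/
structure Node.Holds (v : ℕ → M.D) (N : Node P g) : Prop where
  res : ∀ r ∈ N.R, r.Holds M v
  abduced : ∀ a ∈ N.Δ, M.atomVal v a = 1
  impl : ∀ I ∈ N.PSIC, I.deco = none → I.Holds M v

variable {M}

theorem ResItem.holds_subst (v : ℕ → M.D) (σ : ℕ → L.Term ℕ) (r : ResItem L) :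
    (r.subst σ).Holds M v ↔ r.Holds M fun x => M.eval v (σ x) := by
  cases r <;> simp only [ResItem.subst, ResItem.Holds, Interp.litVal_subst, Interp.eval_subst,
    Interp.eval_liftE, Interp.headVal_subst]

theorem BodyItem.isFalse_subst (η : β → M.D) (σ : α → L.Term β) (b : BodyItem L α) :
    (b.subst σ).IsFalse M η ↔ b.IsFalse M fun x => M.eval η (σ x) := by
  cases b <;> simp only [BodyItem.subst, BodyItem.IsFalse, Interp.litVal_subst, Interp.eval_subst]

theorem BodyItem.exists_mem_map_subst (η : β → M.D) (σ : α → L.Term β)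
    (B : Multiset (BodyItem L α)) :
    (∃ b ∈ B.map (BodyItem.subst σ), b.IsFalse M η) ↔
      ∃ b ∈ B, b.IsFalse M fun x => M.eval η (σ x) := by
  simp only [Multiset.mem_map, exists_exists_and_eq_and, BodyItem.isFalse_subst]

theorem Impl.holds_substE (v : ℕ → M.D) (σ : ℕ → L.Term ℕ) (I : Impl P) :
    (I.substE σ).Holds M v ↔ I.Holds M fun x => M.eval v (σ x) := by
  unfold Impl.Holds Impl.substE
  refine forall_congr' fun z => ?_
  simp only [BodyItem.exists_mem_map_subst, Interp.headVal_subst, Interp.eval_liftE,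
    Set.mem_image, exists_exists_and_eq_and, Interp.ground_subst]

theorem Impl.holds_derive_iff (v : ℕ → M.D) (I : Impl P) (k : ℕ)
    (σ : ℕ ⊕ Fin I.k → L.Term (ℕ ⊕ Fin k)) (B : Multiset (BodyItem L (ℕ ⊕ Fin k))) :
    (I.derive k σ B).Holds M v ↔ ∀ z : Fin k → M.D,
      (∃ b ∈ B, b.IsFalse M (Sum.elim v z)) ∨
      M.headVal (fun x => M.eval (Sum.elim v z) (σ x)) I.head = 1 := by
  unfold Impl.Holds Impl.derive
  simp only [Interp.headVal_subst, Set.mem_empty_iff_false, false_and, exists_false, or_false]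

theorem Impl.holds_withBody_iff (v : ℕ → M.D) (I : Impl P)
    (B : Multiset (BodyItem L (ℕ ⊕ Fin I.k))) :
    (I.withBody B).Holds M v ↔ ∀ z : Fin I.k → M.D,
      (∃ b ∈ B, b.IsFalse M (Sum.elim v z)) ∨ M.headVal (Sum.elim v z) I.head = 1 := by
  unfold Impl.Holds Impl.withBody
  simp only [Set.mem_empty_iff_false, false_and, exists_false, or_false]

theorem Impl.Holds.of_isFalse {v : ℕ → M.D} {I : Impl P} {b B} (hB : I.body = b ::ₘ B)
    (h : ∀ z, b.IsFalse M (Sum.elim v z)) : I.Holds M v :=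
  fun z => Or.inl ⟨b, hB ▸ Multiset.mem_cons_self b B, h z⟩

/-- Replacing a conjunct `b` of a body is sound if `b` is false whenever one of the new conjuncts
is. -/
theorem Impl.Holds.of_withBody {v : ℕ → M.D} {I : Impl P} {b B C} (hB : I.body = b ::ₘ B)
    (h : (I.withBody (C + B)).Holds M v)
    (hC : ∀ z, (∃ c ∈ C, c.IsFalse M (Sum.elim v z)) → b.IsFalse M (Sum.elim v z)) :
    I.Holds M v := by
  intro z
  rcases (I.holds_withBody_iff v _).1 h z with ⟨c, hc, hc'⟩ | hH
  · rcases Multiset.mem_add.1 hc with hc | hc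
    · exact Or.inl ⟨b, hB ▸ Multiset.mem_cons_self b B, hC z ⟨c, hc, hc'⟩⟩
    · exact Or.inl ⟨c, hB ▸ Multiset.mem_cons_of_mem hc, hc'⟩
  · exact Or.inr (Or.inl hH)

theorem Node.holds_subst {v : ℕ → M.D} {σ : ℕ → L.Term ℕ} {N : Node P g}
    (h : (N.subst σ).Holds M v) : N.Holds M fun x => M.eval v (σ x) where
  res r hr := (r.holds_subst v σ).1 (h.res _ (Multiset.mem_map_of_mem _ hr))
  abduced a ha := (M.atomVal_subst v σ a).symm.trans (h.abduced _ ⟨a, ha, rfl⟩)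
  impl I hI hd := (I.holds_substE v σ).1
    (h.impl _ (Multiset.mem_map_of_mem _ hI) (by simp [Impl.substE, hd]))

/-- A step that replaces a conjunct of the resolvent only has to justify this conjunct. -/
theorem Node.Holds.of_res {v : ℕ → M.D} {N N' : Node P g} (h : N'.Holds M v) {r R}
    (hR : N.R = r ::ₘ R) (hR' : R ⊆ N'.R) (hΔ : N.Δ ⊆ N'.Δ) (hI : N.PSIC ⊆ N'.PSIC)
    (hr : r.Holds M v) : N.Holds M v where
  res := by
    rw [hR, Multiset.forall_mem_cons]
    exact ⟨hr, fun r' hr' => h.res r' (hR' hr')⟩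
  abduced a ha := h.abduced a (hΔ ha)
  impl I hI' := h.impl I (hI hI')

/-- A step that replaces an implication only has to justify this implication, and only if it is not
probabilistic. -/
theorem Node.Holds.of_impl {v : ℕ → M.D} {N N' : Node P g} (h : N'.Holds M v) {I J}
    (hI : N.PSIC = I ::ₘ J) (hJ : J ⊆ N'.PSIC) (hR : N.R ⊆ N'.R) (hΔ : N.Δ ⊆ N'.Δ)
    (hI' : I.deco = none → I.Holds M v) : N.Holds M v where
  res r hr := h.res r (hR hr)
  abduced a ha := h.abduced a (hΔ ha)
  impl := by
    rw [hI, Multiset.forall_mem_cons]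
    exact ⟨hI', fun I' hI'' => h.impl I' (hJ hI'')⟩

end Truth

/-! ### Soundness of the transitions on implications -/

section Implications

variable {P : Program L} {M : Interp.{u, v, w} L} {v : ℕ → M.D}

theorem Impl.Holds.of_unfold (hM : IsKBModel P M) {I : Impl P} {a : Atom L (ℕ ⊕ Fin I.k)} {B}
    (hB : I.body = .lit (.pos a) ::ₘ B) (ha : a.pred ∉ P.abd)
    (h : ∀ I' ∈ I.unfold a B, I'.Holds M v) : I.Holds M v := by
  intro z
  by_contra! hI
  obtain ⟨hbody, hhead, -⟩ := hI
  refine hbody _ (hB ▸ Multiset.mem_cons_self _ B) ?_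
  refine hM.val_eq_neg_one ha fun c hc ζ hq => ?_
  have hp : a.pred = c.head.pred := (congrArg Sigma.fst hq).symm
  have hI' := h _ (List.mem_filterMap.2 ⟨c, hc, dif_pos hp⟩)
  -- the old universal variables keep their values `z`, those of the clause get the values `ζ`
  set η : ℕ ⊕ Fin (I.k + c.nvars) → M.D := Sum.elim v (Fin.append z ζ)
  have hold : (fun x => M.eval η (ren (L := L) (Sum.map id (Fin.castAdd c.nvars)) x)) =
      Sum.elim v z := by
    funext x
    cases x <;> simp [ren, Interp.eval, η]
  have hnew : (fun x => M.eval η (ren (L := L) (Sum.inr ∘ Fin.natAdd I.k) x)) = ζ := by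
    funext x
    simp [ren, Interp.eval, η]
  rcases (I.holds_derive_iff v _ _ _).1 hI' (Fin.append z ζ) with ⟨b, hb, hb'⟩ | hH
  · rw [Multiset.mem_add, Multiset.mem_add] at hb
    rcases hb with hb | hb | hb
    · exfalso
      obtain ⟨e, he, rfl⟩ := List.mem_map.1 (Multiset.mem_coe.1 hb)
      refine hb' ((forall_argEqs_iff η _ _ hp).2 ?_ e he)
      rw [Interp.ground_subst, Interp.ground_subst, hold, hnew, hq]
    · obtain ⟨l, hl, rfl⟩ := List.mem_map.1 (Multiset.mem_coe.1 hb)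
      refine (M.litsVal_eq_neg_one_iff ζ _).2 ⟨l, hl, ?_⟩
      rw [← hnew, ← Interp.litVal_subst]
      exact hb'
    · obtain ⟨b', hB', rfl⟩ := Multiset.mem_map.1 hb
      rw [BodyItem.isFalse_subst, hold] at hb'
      exact absurd hb' (hbody b' (hB ▸ Multiset.mem_cons_of_mem hB'))
  · rw [hold] at hH
    exact absurd hH hhead

theorem Impl.Holds.of_propagate {I : Impl P} {a : Atom L ℕ} {b : Atom L (ℕ ⊕ Fin I.k)} {B}
    (hB : I.body = .lit (.pos b) ::ₘ B) (h : a.pred = b.pred)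
    (hI : ({ I with done := insert (a, b) I.done } : Impl P).Holds M v)
    (hI' : (I.withBody (((argEqs (a.subst (ren Sum.inl)) b h).map
      fun e => BodyItem.eq e.1 e.2 : List _) + B)).Holds M v) : I.Holds M v := by
  intro z
  rcases hI z with hb | hH | ⟨e, rfl | he, heq⟩
  · exact Or.inl hb
  · exact Or.inr (Or.inl hH)
  · rcases (I.holds_withBody_iff v _).1 hI' z with ⟨c, hc, hc'⟩ | hH
    · rcases Multiset.mem_add.1 hc with hc | hc
      · obtain ⟨e, he, rfl⟩ := List.mem_map.1 (Multiset.mem_coe.1 hc)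
        refine absurd ((forall_argEqs_iff _ (a.subst (ren Sum.inl)) b h).2 ?_ e he) hc'
        rw [Interp.ground_subst]
        exact heq
      · exact Or.inl ⟨c, hB ▸ Multiset.mem_cons_of_mem hc, hc'⟩
    · exact Or.inr (Or.inl hH)
  · exact Or.inr (Or.inr ⟨e, he, heq⟩)

/-- Specialising an implication by `σ` is sound if the equation `s = t` in its body fails for all
values of the universal variables that `σ` does not leave unchanged. -/
theorem Impl.Holds.of_derive {I : Impl P} {s t : L.Term (ℕ ⊕ Fin I.k)} {B}
    (hB : I.body = .eq s t ::ₘ B) {σ : ℕ ⊕ Fin I.k → L.Term (ℕ ⊕ Fin I.k)}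
    (h : (I.derive I.k σ (B.map (BodyItem.subst σ))).Holds M v)
    (hσ : ∀ z, M.eval (Sum.elim v z) s = M.eval (Sum.elim v z) t →
      (fun x => M.eval (Sum.elim v z) (σ x)) = Sum.elim v z) : I.Holds M v := by
  intro z
  by_cases hst : M.eval (Sum.elim v z) s = M.eval (Sum.elim v z) t
  · have := (I.holds_derive_iff v _ _ _).1 h z
    rw [BodyItem.exists_mem_map_subst, hσ z hst] at this
    rcases this with ⟨b, hb, hb'⟩ | hH
    · exact Or.inl ⟨b, hB ▸ Multiset.mem_cons_of_mem hb, hb'⟩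
    · exact Or.inr (Or.inl hH)
  · exact Or.inl ⟨.eq s t, hB ▸ Multiset.mem_cons_self _ B, hst⟩

/-- Case analysis picks values for the universal variables of `r` with `x = r`. By Clark's equality
theory there are no other such values, so that nothing is lost for the other ones. -/
theorem Interp.CET.eval_makeExistential (hM : M.CET) {k n : ℕ} {x : ℕ}
    {r : L.Term (ℕ ⊕ Fin k)} (hx : v x = M.eval v (r.subst (lower n))) (z : Fin k → M.D)
    (hz : v x = M.eval (Sum.elim v z) r) :
    (fun y => M.eval (Sum.elim v z) (makeExistential n r y)) = Sum.elim v z := by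
  have hr : M.eval (Sum.elim v fun y : Fin k => v (n + y)) r = M.eval (Sum.elim v z) r := by
    rw [← hz, hx, Interp.eval_subst]
    congr 1
    funext y
    cases y <;> simp [lower, ren, Interp.eval]
  funext y
  cases y with
  | inl y => rfl
  | inr y =>
    by_cases hy : Sum.inr y ∈ r.varFinset
    · simpa [makeExistential, hy, Interp.eval] using hM.eq_of_eval_eq r hr _ hy
    · simp [makeExistential, hy, Interp.eval]

theorem Impl.Holds.of_head {I : Impl P} (H : Head L ℕ) (hH : I.head = substHead H (ren Sum.inl))
    (h : M.headVal v H = 1) : I.Holds M v := by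
  intro z
  rw [hH, Interp.headVal_subst]
  exact Or.inr (Or.inl h)

end Implications

/-! ### Invariants of derivations -/

section Invariants

variable {P : Program L} {g : ℕ} {M : Interp.{u, v, w} L}

/-- The head of a probabilistic implication is the head of the constraint in its decoration. -/
def Impl.HeadMatchesDeco (I : Impl P) : Prop :=
  ∀ d, I.deco = some d → I.head = substHead (P.pic d.1).ic.head d.2

/-- What all nodes of a derivation have in common, regardless of any structure. -/
structure Node.WellFormed (N : Node P g) : Prop where
  composite : IsCompositeChoice N.E
  abducible : ∀ a ∈ N.Δ, a.pred ∈ P.abd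
  deco : ∀ I ∈ N.PSIC, I.HeadMatchesDeco

theorem Impl.HeadMatchesDeco.of_none {I : Impl P} (h : I.deco = none) : I.HeadMatchesDeco :=
  fun d hd => by simp [h] at hd

theorem Impl.HeadMatchesDeco.derive {I : Impl P} (h : I.HeadMatchesDeco) (k : ℕ)
    (σ : ℕ ⊕ Fin I.k → L.Term (ℕ ⊕ Fin k)) (B : Multiset (BodyItem L (ℕ ⊕ Fin k))) :
    (I.derive k σ B).HeadMatchesDeco := by
  intro d hd
  obtain ⟨d, hd', rfl⟩ := Option.map_eq_some_iff.1 hd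
  simp only [Impl.derive, h d hd', substHead_substHead]
  rfl

theorem Impl.HeadMatchesDeco.withBody {I : Impl P} (h : I.HeadMatchesDeco)
    (B : Multiset (BodyItem L (ℕ ⊕ Fin I.k))) : (I.withBody B).HeadMatchesDeco :=
  h

theorem Impl.HeadMatchesDeco.substE {I : Impl P} (h : I.HeadMatchesDeco) (σ : ℕ → L.Term ℕ) :
    (I.substE σ).HeadMatchesDeco := by
  intro d hd
  obtain ⟨d, hd', rfl⟩ := Option.map_eq_some_iff.1 hd
  simp only [Impl.substE, h d hd', substHead_substHead]
  rfl

theorem Impl.HeadMatchesDeco.unfold {I : Impl P} (h : I.HeadMatchesDeco)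
    (a : Atom L (ℕ ⊕ Fin I.k)) (B : Multiset (BodyItem L (ℕ ⊕ Fin I.k))) :
    ∀ I' ∈ I.unfold a B, I'.HeadMatchesDeco := by
  intro I' hI'
  obtain ⟨c, -, hc⟩ := List.mem_filterMap.1 hI'
  split_ifs at hc
  obtain rfl := Option.some.inj hc
  exact h.derive _ _ _

theorem IsCompositeChoice.insert {E : Set (AtomicChoice P)} (hE : IsCompositeChoice E)
    {d : Inst P (ℕ ⊕ ℕ)} {k : Bool} (h : (d, !k) ∉ E) : IsCompositeChoice (insert (d, k) E) := by
  rintro x ⟨h₁, h₂⟩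
  by_cases hx : x = d
  · subst hx
    cases k with
    | true => exact h (h₂.resolve_left (by simp))
    | false => exact h (h₁.resolve_left (by simp))
  · exact hE x ⟨h₁.resolve_left (by simp [hx]), h₂.resolve_left (by simp [hx])⟩

theorem Node.WellFormed.of_impl {N N' : Node P g} (hN : N.WellFormed) {I J K}
    (hI : N.PSIC = I ::ₘ J) (hK : I.HeadMatchesDeco → ∀ I' ∈ K, I'.HeadMatchesDeco)
    (hP : N'.PSIC = K + J) (hΔ : N'.Δ = N.Δ) (hE : IsCompositeChoice N'.E) : N'.WellFormed where
  composite := hE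
  abducible := hΔ ▸ hN.abducible
  deco I' hI' := by
    rw [hP, Multiset.mem_add] at hI'
    rcases hI' with hI' | hI'
    · exact hK (hN.deco I (hI ▸ Multiset.mem_cons_self I J)) I' hI'
    · exact hN.deco I' (hI ▸ Multiset.mem_cons_of_mem hI')

theorem Step.wellFormed {N N' : Node P g} (hstep : Step N N') (hN : N.WellFormed) :
    N'.WellFormed := by
  cases hstep with
  | abduce hR ha =>
    exact ⟨hN.composite, fun b hb => hb.elim (fun h => h ▸ ha) (hN.abducible b), hN.deco⟩
  | negation hR =>
    refine ⟨hN.composite, hN.abducible, ?_⟩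
    rw [Multiset.forall_mem_cons]
    exact ⟨.of_none rfl, hN.deco⟩
  | eqSubst hR h hx hE =>
    refine ⟨hE, ?_, ?_⟩
    · rintro _ ⟨a, ha, rfl⟩
      exact hN.abducible a ha
    · intro I hI
      obtain ⟨I', hI', rfl⟩ := Multiset.mem_map.1 hI
      exact (hN.deco I' hI').substE _
  | unfoldGoal | split | eqDecompose | eqClash | eqRefl | eqOccurs | neqDecompose | neqClash |
    neqRefl | neqOccurs | neqUniversal | factorEq | factorNeq =>
    exact ⟨hN.composite, hN.abducible, hN.deco⟩
  | @propagate I J hI a ha b B =>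
    refine hN.of_impl hI (K := {{ I with done := insert (a, b) I.done }, I.withBody _})
      (fun h => ?_) (by simp only [Multiset.insert_eq_cons, Multiset.cons_add,
        Multiset.singleton_add]; rfl) rfl hN.composite
    simp only [Multiset.insert_eq_cons, Multiset.mem_cons, Multiset.mem_singleton,
      forall_eq_or_imp, forall_eq]
    exact ⟨h, h.withBody _⟩
  | unfoldBody hI => exact hN.of_impl hI (fun h => h.unfold _ _) rfl rfl hN.composite
  | bodyDecompose hI | bodyRefl hI | negRight hI =>
    exact hN.of_impl hI (K := {_}) (fun h => by simpa using h.withBody _) rfl rfl hN.composite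
  | bodySubst hI | caseEq hI =>
    exact hN.of_impl hI (K := {_}) (fun h => by simpa using h.derive _ _ _) rfl rfl hN.composite
  | bodyClash hI | bodyOccurs hI | caseNeq hI | negLeft hI | impliesHead hI | flounder hI =>
    exact hN.of_impl hI (K := 0) (by simp) (zero_add _).symm rfl hN.composite
  | choose hI hB hd H hH hE | discard hI hB hd hE =>
    exact hN.of_impl hI (K := 0) (by simp) (zero_add _).symm rfl (hN.composite.insert hE)

theorem wellFormed_initialNode (P : Program L) (G : Goal L) : (initialNode P G).WellFormed where
  composite _ h := h.1
  abducible _ h := h.elim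
  deco I hI := by
    rcases List.mem_append.1 (Multiset.mem_coe.1 hI) with hI | hI
    · obtain ⟨c, -, rfl⟩ := List.mem_map.1 hI
      exact .of_none rfl
    · obtain ⟨i, rfl⟩ := List.mem_ofFn.1 hI
      intro d hd
      obtain rfl := Option.some.inj hd
      rfl

end Invariants

/-! ### Soundness of the transitions -/

section Steps

variable {P : Program L} {g : ℕ} {M : Interp.{u, v, w} L}

/-- The head of an instance of a probabilistic constraint is true, for all values of its universal
variables. -/
def Inst.HeadHolds (M : Interp.{u, v, w} L) (v : ℕ → M.D) (d : Inst P (ℕ ⊕ ℕ)) : Prop :=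
  ∀ z : ℕ → M.D, M.headVal (fun x => M.eval (Sum.elim v z) (d.2 x)) (P.pic d.1).ic.head = 1

/-- The heads of all chosen instances are true. -/
def Node.ChosenHold (M : Interp.{u, v, w} L) (v : ℕ → M.D) (N : Node P g) : Prop :=
  ∀ d, (d, true) ∈ N.E → d.HeadHolds M v

theorem Inst.headHolds_subst (v : ℕ → M.D) (σ : ℕ → L.Term ℕ) (d : Inst P (ℕ ⊕ ℕ)) :
    (d.subst (liftE σ)).HeadHolds M v ↔ d.HeadHolds M fun x => M.eval v (σ x) := by
  simp only [Inst.HeadHolds, Inst.subst, Interp.eval_subst, Interp.eval_liftE]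

/-- The instance recorded when a probabilistic implication is chosen has a true head, as soon as the
conjunct `H` that the choice adds to the resolvent is true. -/
theorem Impl.HeadMatchesDeco.headHolds {v : ℕ → M.D} {I : Impl P} (hI : I.HeadMatchesDeco) {d}
    (hd : I.deco = some d) {H : Head L ℕ} (hH : I.head = substHead H (ren Sum.inl))
    (h : M.headVal v H = 1) : (d.subst (ren (Sum.map id Fin.val))).HeadHolds M v := by
  intro z
  have key : M.headVal (Sum.elim v fun y : Fin I.k => z y) I.head = 1 := by
    rw [hH, Interp.headVal_subst]
    exact h
  rw [hI d hd, Interp.headVal_subst] at key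
  have hz : (fun y => M.eval (Sum.elim v z) (ren (L := L) (Sum.map id Fin.val) y)) =
      Sum.elim v fun y : Fin I.k => z y := by
    funext y
    cases y <;> rfl
  simpa only [Inst.subst, Interp.eval_subst, hz] using key

/-- A transition is sound: if the existential variables of the new node can be given values that
make it true, then so can those of the old node, without changing the answer substitution. -/
theorem Step.exists_holds (hM : IsKBModel P M) {N N' : Node P g} (hstep : Step N N')
    (hN : N.WellFormed) {v' : ℕ → M.D} (h : N'.Holds M v') :
    ∃ v : ℕ → M.D, N.Holds M v ∧ (∀ x, M.eval v (N.θ x) = M.eval v' (N'.θ x)) ∧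
      (N.ChosenHold M v → N'.ChosenHold M v') := by
  -- all transitions but one keep the values of the existential variables
  have same (hH : N.Holds M v') (hθ : N'.θ = N.θ)
      (hE : N.ChosenHold M v' → N'.ChosenHold M v') : ∃ v : ℕ → M.D, N.Holds M v ∧
      (∀ x, M.eval v (N.θ x) = M.eval v' (N'.θ x)) ∧ (N.ChosenHold M v → N'.ChosenHold M v') :=
    ⟨v', hH, fun x => by rw [hθ], hE⟩
  cases hstep with
  | @eqSubst R s t x r hR hst hx hE =>
    have h' := Node.holds_subst h
    have hv : (fun y => M.eval v' (single x r y)) x =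
        M.eval (fun y => M.eval v' (single x r y)) r := by
      have : M.eval (fun y => M.eval v' (single x r y)) r = M.eval v' r := by
        refine M.eval_congr r fun y hy => ?_
        have : y ≠ x := fun e => hx (e ▸ hy)
        simp [single, this, Interp.eval]
      rw [this]
      simp [single]
    refine ⟨_, ?_, fun y => (M.eval_subst v' (single x r) (N.θ y)).symm, ?_⟩
    · exact Node.Holds.of_res h' hR (fun _ h => h) (fun _ h => h) (fun _ h => h)
        ((hst.eval_eq_iff _).2 hv)
    · rintro hC _ ⟨⟨d, _⟩, hd, hd'⟩
      obtain ⟨rfl, rfl⟩ := Prod.mk.inj hd'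
      exact (Inst.headHolds_subst v' _ d).2 (hC d hd)
  | @abduce R a hR ha =>
    exact same (h.of_res hR (fun _ h => h) (fun _ h => Or.inr h) (fun _ h => h)
      (h.abduced a (Or.inl rfl))) rfl id
  | @negation R a hR =>
    refine same (h.of_res hR (fun _ h => h) (fun _ h => h)
      (fun _ h => Multiset.mem_cons_of_mem h) ?_) rfl id
    rcases h.impl _ (Multiset.mem_cons_self _ _) rfl (fun y => y.elim0) with
      ⟨b, hb, hb'⟩ | hH | ⟨e, he, -⟩
    · obtain rfl := Multiset.mem_singleton.1 hb
      have hb' : M.atomVal _ (a.subst (ren Sum.inl)) = -1 := hb'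
      rw [Interp.atomVal_subst] at hb'
      change -M.atomVal v' a = 1
      have e : M.atomVal v' a = -1 := hb'
      rw [e]; rfl
    · exact absurd hH (M.headVal_nil_ne_one _)
    · exact he.elim
  | @unfoldGoal R a hR ha c hc hp =>
    refine same (h.of_res hR (fun r hr => Multiset.mem_add.2 (.inr (Multiset.mem_add.2 (.inr hr))))
      (fun _ h => h) (fun _ h => h) ?_) rfl id
    have hground : M.ground v' a = M.ground (fun y : Fin c.nvars => v' (N.next + y)) c.head := by
      have := (forall_argEqs_iff v' a (c.head.subst (ren fun y => N.next + y)) hp).1 fun e he =>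
        h.res (.eq e.1 e.2) (Multiset.mem_add.2 (.inl (Multiset.mem_coe.2
          (List.mem_map_of_mem he))))
      rw [this, Interp.ground_subst]
      rfl
    change M.val _ = 1
    rw [hground]
    refine hM.val_eq_one_of_clause hc _ ((M.litsVal_eq_one_iff _ _).2 fun l hl => ?_)
    have := h.res (.lit (l.subst (ren fun y => N.next + y))) (Multiset.mem_add.2 (.inr
      (Multiset.mem_add.2 (.inl (Multiset.mem_coe.2 (List.mem_map_of_mem
        (f := fun l => ResItem.lit (l.subst (ren fun y => N.next + y))) hl))))))
    exact (M.litVal_subst v' _ l).symm.trans this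
  | @split R H hR c hc =>
    refine same (h.of_res hR (fun r hr => Multiset.mem_add.2 (.inr hr))
      (fun _ h => h) (fun _ h => h) ?_) rfl id
    refine (M.headVal_eq_one_iff v' H).2 ⟨c, hc, (M.litsVal_eq_one_iff v' c).2 fun l hl => ?_⟩
    exact h.res (.lit l) (Multiset.mem_add.2 (.inl (Multiset.mem_coe.2 (List.mem_map_of_mem hl))))
  | @eqDecompose R n f ss ts hR =>
    refine same (h.of_res hR (fun r hr => Multiset.mem_add.2 (.inr hr))
      (fun _ h => h) (fun _ h => h) ?_) rfl id
    exact (hM.1.eval_func_eq_iff v' f ss ts).2 fun j => h.res (.eq (ss j) (ts j))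
      (Multiset.mem_add.2 (.inl (Multiset.mem_coe.2 (List.mem_ofFn.2 ⟨j, rfl⟩))))
  | eqRefl hR =>
    exact same (h.of_res hR (fun r hr => hr) (fun _ h => h) (fun _ h => h) rfl) rfl id
  | eqClash | eqOccurs | neqRefl | neqUniversal | flounder =>
    exact absurd (h.res _ (Multiset.mem_cons_self _ _)) (M.headVal_nil_ne_one v')
  | @neqDecompose R k n f ss ts hR j =>
    refine same (h.of_res hR (fun r hr => Multiset.mem_cons_of_mem hr)
      (fun _ h => h) (fun _ h => h) ?_) rfl id
    exact fun z hz => h.res (.neq k (ss j) (ts j)) (Multiset.mem_cons_self _ _) z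
      ((hM.1.eval_func_eq_iff _ f ss ts).1 hz j)
  | neqClash hR hst =>
    exact same (h.of_res hR (fun r hr => hr) (fun _ h => h) (fun _ h => h)
      fun z => hM.1.eval_ne_of_clash _ hst) rfl id
  | neqOccurs hR hst hx hr =>
    exact same (h.of_res hR (fun r hr => hr) (fun _ h => h) (fun _ h => h)
      fun z hz => hM.1.eval_ne_of_occurs _ hx hr ((hst.eval_eq_iff _).1 hz).symm) rfl id
  | factorEq | factorNeq =>
    refine same ⟨fun r hr => h.res r ?_, h.abduced, h.impl⟩ rfl id
    first
      | exact Multiset.mem_add.2 (.inr hr)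
      | exact Multiset.mem_cons_of_mem hr
  | propagate hI ha hB hb hd hp =>
    refine same (h.of_impl hI (fun _ h => Multiset.mem_cons_of_mem (Multiset.mem_cons_of_mem h))
      (fun _ h => h) (fun _ h => h) fun hn => ?_) rfl id
    exact .of_propagate hB hp (h.impl _ (Multiset.mem_cons_self _ _) hn)
      (h.impl _ (Multiset.mem_cons_of_mem (Multiset.mem_cons_self _ _)) hn)
  | @unfoldBody I J hI a B hB ha =>
    refine same (h.of_impl hI (fun _ h => Multiset.mem_add.2 (.inr h))
      (fun _ h => h) (fun _ h => h) fun hn => ?_) rfl id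
    refine .of_unfold hM hB ha fun I' hI' =>
      h.impl I' (Multiset.mem_add.2 (.inl (Multiset.mem_coe.2 hI'))) ?_
    obtain ⟨c, -, hc⟩ := List.mem_filterMap.1 hI'
    split_ifs at hc
    obtain rfl := Option.some.inj hc
    simp [Impl.derive, hn]
  | @bodyDecompose I J hI n f ss ts B hB =>
    refine same (h.of_impl hI (fun _ h => Multiset.mem_cons_of_mem h)
      (fun _ h => h) (fun _ h => h) fun hn => ?_) rfl id
    refine .of_withBody hB (h.impl _ (Multiset.mem_cons_self _ _) hn) ?_
    rintro z ⟨c, hc, hc'⟩ heq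
    obtain ⟨j, rfl⟩ := List.mem_ofFn.1 (Multiset.mem_coe.1 hc)
    exact hc' ((hM.1.eval_func_eq_iff _ f ss ts).1 heq j)
  | bodyClash hI hB hst =>
    exact same (h.of_impl hI (fun _ h => h) (fun _ h => h) (fun _ h => h) fun _ =>
      .of_isFalse hB fun z => hM.1.eval_ne_of_clash _ hst) rfl id
  | bodyOccurs hI hB hst hx hr =>
    exact same (h.of_impl hI (fun _ h => h) (fun _ h => h) (fun _ h => h) fun _ =>
      .of_isFalse hB fun z hz =>
        hM.1.eval_ne_of_occurs _ hx hr ((hst.eval_eq_iff _).1 hz).symm) rfl id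
  | bodyRefl hI hB | negRight hI hB =>
    refine same (h.of_impl hI (fun _ h => Multiset.mem_cons_of_mem h)
      (fun _ h => h) (fun _ h => h) fun hn => ?_) rfl id
    refine .of_withBody hB (C := 0) ?_ (by simp)
    rw [zero_add]
    exact h.impl _ (Multiset.mem_cons_self _ _) hn
  | bodySubst hI hB hst hy =>
    refine same (h.of_impl hI (fun _ h => Multiset.mem_cons_of_mem h)
      (fun _ h => h) (fun _ h => h) fun hn => ?_) rfl id
    exact .of_derive hB (h.impl _ (Multiset.mem_cons_self _ _) (by simp [Impl.derive, hn]))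
      fun z hz => M.eval_single _ ((hst.eval_eq_iff _).1 hz)
  | caseEq hI hB hst hx hr =>
    refine same (h.of_impl hI (fun _ h => Multiset.mem_cons_of_mem h)
      (fun _ h => Multiset.mem_cons_of_mem h) (fun _ h => h) fun hn => ?_) rfl id
    exact .of_derive hB (h.impl _ (Multiset.mem_cons_self _ _) (by simp [Impl.derive, hn]))
      fun z hz => hM.1.eval_makeExistential (h.res _ (Multiset.mem_cons_self _ _)) z
        ((hst.eval_eq_iff _).1 hz)
  | caseNeq hI hB hst hx hr =>
    exact same (h.of_impl hI (fun _ h => h) (fun _ h => Multiset.mem_cons_of_mem h)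
      (fun _ h => h) fun _ => .of_isFalse hB fun z hz =>
        h.res _ (Multiset.mem_cons_self _ _) z ((hst.eval_eq_iff _).1 hz)) rfl id
  | negLeft hI hB hneg a₀ ha =>
    refine same (h.of_impl hI (fun _ h => h) (fun _ h => Multiset.mem_cons_of_mem h)
      (fun _ h => h) fun _ => .of_isFalse hB fun z => ?_) rfl id
    have : M.atomVal v' a₀ = 1 := h.res _ (Multiset.mem_cons_self _ _)
    change -M.atomVal _ _ = -1
    rw [ha, Interp.atomVal_subst, neg_inj]
    exact this
  | impliesHead hI hB hd H hH =>
    exact same (h.of_impl hI (fun _ h => h) (fun _ h => Multiset.mem_cons_of_mem h)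
      (fun _ h => h) fun _ => .of_head H hH (h.res _ (Multiset.mem_cons_self _ _))) rfl id
  | choose hI hB hd H hH hE =>
    refine same (h.of_impl hI (fun _ h => h) (fun _ h => Multiset.mem_cons_of_mem h)
      (fun _ h => h) fun hn => by simp [hn] at hd) rfl ?_
    rintro hC d' (hd' | hd')
    · obtain ⟨rfl, -⟩ := Prod.mk.inj hd'
      exact (hN.deco _ (hI ▸ Multiset.mem_cons_self _ _)).headHolds hd hH
        (h.res _ (Multiset.mem_cons_self _ _))
    · exact hC d' hd'
  | discard hI hB hd hE =>
    refine same (h.of_impl hI (fun _ h => h) (fun _ h => h)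
      (fun _ h => h) fun hn => by simp [hn] at hd) rfl ?_
    rintro hC d' (hd' | hd')
    · simp at hd'
    · exact hC d' hd'

theorem exists_holds_of_reflTransGen (hM : IsKBModel P M) {N N' : Node P g}
    (hsteps : Relation.ReflTransGen Step N N') (hN : N.WellFormed) {v' : ℕ → M.D}
    (h : N'.Holds M v') :
    ∃ v : ℕ → M.D, N.Holds M v ∧ (∀ x, M.eval v (N.θ x) = M.eval v' (N'.θ x)) ∧
      (N.ChosenHold M v → N'.ChosenHold M v') := by
  induction hsteps using Relation.ReflTransGen.head_induction_on with
  | refl => exact ⟨v', h, fun _ => rfl, id⟩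
  | head hstep _ ih =>
    obtain ⟨v₁, h₁, hθ₁, hC₁⟩ := ih (hstep.wellFormed hN)
    obtain ⟨v₀, h₀, hθ₀, hC₀⟩ := hstep.exists_holds hM hN h₁
    exact ⟨v₀, h₀, fun x => (hθ₀ x).trans (hθ₁ x), hC₁ ∘ hC₀⟩

end Steps

/-! ### Final nodes -/

section Final

variable {P : Program L} {g : ℕ} {M : Interp.{u, v, w} L}

/-- Some transition applies to every equation in the body of an implication. -/
theorem exists_step_of_body_eq {N : Node P g} {I J} (hI : N.PSIC = I ::ₘ J)
    {s t : L.Term (ℕ ⊕ Fin I.k)} {B} (hB : I.body = .eq s t ::ₘ B) : ∃ N', Step N N' := by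
  have var {x : ℕ ⊕ Fin I.k} {r : L.Term (ℕ ⊕ Fin I.k)} (h : IsVarEq s t x r) :
      ∃ N', Step N N' := by
    by_cases hx : x ∈ r.varFinset
    · by_cases hr : r = .var x
      · subst hr
        obtain ⟨rfl, rfl⟩ : s = .var x ∧ t = .var x := by
          rcases h with h | h
          · exact h
          · exact h.symm
        exact ⟨_, .bodyRefl hI hB⟩
      · exact ⟨_, .bodyOccurs hI hB h hx hr⟩
    · cases x with
      | inr y => exact ⟨_, .bodySubst hI hB h hx⟩
      | inl x =>
        by_cases hr : ∃ y, r = .var (Sum.inr y)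
        · obtain ⟨y, rfl⟩ := hr
          have h' : IsVarEq s t (Sum.inr y) (.var (Sum.inl x)) := by
            rcases h with ⟨rfl, rfl⟩ | ⟨rfl, rfl⟩
            · exact Or.inr ⟨rfl, rfl⟩
            · exact Or.inl ⟨rfl, rfl⟩
          exact ⟨_, .bodySubst hI hB h' (by simp [FirstOrder.Language.Term.varFinset])⟩
        · exact ⟨_, .caseNeq hI hB h hx (not_exists.1 hr)⟩
  cases s with
  | var x => exact var (Or.inl ⟨rfl, rfl⟩)
  | @func m f ss =>
    cases t with
    | var x => exact var (Or.inr ⟨rfl, rfl⟩)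
    | @func n f' ts =>
      by_cases hf : (⟨m, f⟩ : Σ k, L.Functions k) = ⟨n, f'⟩
      · cases hf
        exact ⟨_, .bodyDecompose hI hB⟩
      · exact ⟨_, .bodyClash hI hB ⟨m, n, f, f', ss, ts, rfl, rfl, hf⟩⟩

/-- An implication that is not probabilistic and to which no transition applies is stuck at an
abducible atom of its body, on which propagation has been applied with all abduced atoms. -/
theorem exists_propagated_atom {N : Node P g} (hfinal : ∀ N', ¬ Step N N') {I}
    (hI : I ∈ N.PSIC) (hd : I.deco = none) : ∃ b : Atom L (ℕ ⊕ Fin I.k),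
      .lit (.pos b) ∈ I.body ∧ b.pred ∈ P.abd ∧ ∀ a ∈ N.Δ, a.pred = b.pred → (a, b) ∈ I.done := by
  obtain ⟨J, hJ⟩ := Multiset.exists_cons_of_mem hI
  by_cases hpos : ∃ b, BodyItem.lit (Literal.pos b) ∈ I.body
  · obtain ⟨b, hb⟩ := hpos
    obtain ⟨B, hB⟩ := Multiset.exists_cons_of_mem hb
    have hb' : b.pred ∈ P.abd := by
      by_contra hb'
      exact hfinal _ (.unfoldBody hJ hB hb')
    refine ⟨b, hb, hb', fun a ha hab => ?_⟩
    by_contra hdone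
    exact hfinal _ (.propagate hJ ha hB hb' hdone hab)
  · exfalso
    have hneg : ∀ b ∈ I.body, ∃ a', b = .lit (.neg a') := by
      rintro ((a | a) | ⟨s, t⟩) hb
      · exact absurd ⟨a, hb⟩ hpos
      · exact ⟨a, rfl⟩
      · obtain ⟨B, hB⟩ := Multiset.exists_cons_of_mem hb
        obtain ⟨N', hN'⟩ := exists_step_of_body_eq hJ hB
        exact absurd hN' (hfinal N')
    rcases I.body.empty_or_exists_mem with hB | ⟨b, hb⟩
    · by_cases hH : ∃ H : Head L ℕ, I.head = substHead H (ren Sum.inl)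
      · obtain ⟨H, hH⟩ := hH
        exact hfinal _ (.impliesHead hJ hB hd H hH)
      · exact hfinal _ (.flounder hJ hB hH)
    · obtain ⟨a, rfl⟩ := hneg b hb
      obtain ⟨B, hB⟩ := Multiset.exists_cons_of_mem hb
      exact hfinal _ (.negRight hJ hB fun b hb => hneg b (hB ▸ Multiset.mem_cons_of_mem hb))

theorem Node.holds_of_final {N : Node P g} (hfinal : ∀ N', ¬ Step N N') (hR : N.R = 0)
    {v : ℕ → M.D} (hM : IsCompletionModel P N.Δ M v) : N.Holds M v where
  res r hr := by simp [hR] at hr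
  abduced _ ha := hM.atomVal_eq_one_of_mem ha
  impl I hI hd z := by
    obtain ⟨b, hb, hb', hdone⟩ := exists_propagated_atom hfinal hI hd
    by_cases h : ∃ a ∈ N.Δ, M.ground v a = M.ground (Sum.elim v z) b
    · obtain ⟨a, ha, heq⟩ := h
      exact Or.inr (Or.inr ⟨(a, b), hdone a ha (congrArg Sigma.fst heq), heq⟩)
    · push Not at h
      exact Or.inl ⟨_, hb, hM.val_eq_neg_one_of_abducible hb' h⟩

end Final

/-! ### Initial nodes -/

section Initial

variable {P : Program L} {G : Goal L} {M : Interp.{u, v, w} L} {v : ℕ → M.D}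

theorem Node.Holds.goal (h : (initialNode P G).Holds M v) :
    M.litsVal (fun x => M.eval v ((initialNode P G).θ x)) G.lits = 1 := by
  refine (M.litsVal_eq_one_iff _ _).2 fun l hl => ?_
  exact (M.litVal_subst v _ l).symm.trans (h.res (.lit (l.subst (ren Fin.val)))
    (Multiset.mem_coe.2 (List.mem_map_of_mem
      (f := fun l => ResItem.lit (l.subst (ren Fin.val))) hl)))

theorem Node.Holds.icVal (h : (initialNode P G).Holds M v) {c : IC L} (hc : c ∈ P.ics)
    (η : Fin c.nvars → M.D) : M.icVal c η = 1 := by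
  rw [Interp.icVal_eq_one_iff]
  rcases h.impl (c.toImpl P) (Multiset.mem_coe.2 (List.mem_append.2 (.inl
    (List.mem_map_of_mem hc)))) rfl η with ⟨b, hb, hb'⟩ | hH | ⟨e, he, -⟩
  · obtain ⟨a, ha, rfl⟩ := List.mem_map.1 (Multiset.mem_coe.1 hb)
    exact Or.inl ⟨a, ha, (M.atomVal_subst _ _ a).symm.trans hb'⟩
  · exact Or.inr ((M.headVal_subst _ _ c.head).symm.trans hH)
  · exact he.elim

end Initial

end ProbIFF

theorem mainTheorem1 {L : FirstOrder.Language.{u, v}} (P : ProbIFF.Program L)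
    (G : ProbIFF.Goal L) (Δ : Set (ProbIFF.Atom L ℕ)) (θ : Fin G.nvars → L.Term ℕ)
    (E : Set (ProbIFF.AtomicChoice P)) (h : ProbIFF.SuccessfulDerivation P G Δ θ E) :
    ProbIFF.IsProbAbductiveAnswer.{u, v, w} P G Δ θ E := by
  obtain ⟨N, hsteps, hfinal, hR, rfl, rfl, rfl⟩ := h
  have hinit := ProbIFF.wellFormed_initialNode P G
  have hN : N.WellFormed :=
    Relation.ReflTransGen.head_induction_on (motive := fun N₀ _ => N₀.WellFormed → N.WellFormed)
      hsteps id (fun hstep _ ih h₀ => ih (hstep.wellFormed h₀)) hinit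
  have key {M : ProbIFF.Interp.{u, v, w} L} {v : ℕ → M.D}
      (hM : ProbIFF.IsCompletionModel P N.Δ M v) :=
    ProbIFF.exists_holds_of_reflTransGen (hM.isKBModel hN.abducible) hsteps hinit
      (ProbIFF.Node.holds_of_final hfinal hR hM)
  refine ⟨hN.abducible, hN.composite, fun M v hM => ?_, fun c hc M v hM => ?_,
    fun i τ hτ M v hM z => ?_⟩
  · obtain ⟨v₀, h₀, hθ, -⟩ := key hM
    simpa only [hθ] using h₀.goal
  · obtain ⟨v₀, h₀, -, -⟩ := key hM
    exact h₀.icVal hc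
  · -- no choices have been made at the initial node
    obtain ⟨v₀, -, -, hC⟩ := key hM
    exact (M.icVal_eq_one_iff _ _).2 (Or.inr (hC (fun _ hd => hd.elim) ⟨i, τ⟩ hτ z))
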